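/- For positive integers $r,p,k$ with $p\ge 3$ and $2\le k\le\binom p2$, let $F_\chi(r,p,k)$ be the minimum integer $n$ such that every edge-coloring of the complete graph $K_n$ with $r$ colors contains a $p$-chromatic subgraph (a subgraph of chromatic number exactly $p$) receiving at most $k-1$ distinct colors on its edges. Theorem. Let $q\ge 2$ be an integer. There is a constant $C=C_q$, depending only on $q$, such that for all integers $r\ge 2$ the number $F_\chi(r,2^q,q+1)$ exists (is finite) and $$F_\chi(r,2^q,q+1)\le e^{C\,r^{1-1/q}(\log r)^q},$$ where $\log$ is the natural logarithm. In terms of colorings, with the same constant $C$: for all integers $r\ge 2$ and $n\ge 0$, if there is an edge-coloring of $K_n$ with $r$ colors in which the union of any at most $q$ color classes has chromatic number at most $2^q-1$, then $n\le e^{C\,r^{1-1/q}(\log r)^q}$. -/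

import Mathlib

namespace ChromaticRamsey

/-- The set of colors that an edge-coloring `c` of the complete graph uses on the edges of a
subgraph `H`. -/
def colorsOn {n r : ℕ} (c : SimpleGraph.TopEdgeLabeling (Fin n) (Fin r))
    (H : (⊤ : SimpleGraph (Fin n)).Subgraph) : Set (Fin r) :=
  {i | ∃ (e : Sym2 (Fin n)) (he : e ∈ H.edgeSet), c ⟨e, H.edgeSet_subset he⟩ = i}

/-- Every edge-coloring of `K_n` with `r` colors contains a `p`-chromatic subgraph (one whose
chromatic number is exactly `p`) receiving at most `q - 1` distinct colors on its edges. -/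
def Forces (r p q n : ℕ) : Prop :=
  ∀ c : SimpleGraph.TopEdgeLabeling (Fin n) (Fin r),
    ∃ H : (⊤ : SimpleGraph (Fin n)).Subgraph,
      H.coe.chromaticNumber = (p : ℕ∞) ∧ (colorsOn c H).ncard ≤ q - 1

/-- The chromatic generalized Ramsey number `F_χ(r, p, q)`: the minimum `n` such that every
edge-coloring of `K_n` with `r` colors contains a `p`-chromatic subgraph receiving at most `q - 1`
distinct colors (meaningful when there is such an `n`). -/
noncomputable def Fchi (r p q : ℕ) : ℕ :=
  sInf {n : ℕ | Forces r p q n}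

/-- A chromatic-`(p, q)`-coloring: the union of any (at most) `q - 1` color classes has chromatic
number at most `p - 1`. -/
def IsChromaticColoring {n r : ℕ} (p q : ℕ)
    (c : SimpleGraph.TopEdgeLabeling (Fin n) (Fin r)) : Prop :=
  ∀ S : Finset (Fin r), S.card ≤ q - 1 →
    (⨆ i ∈ S, c.labelGraph i).chromaticNumber ≤ ((p - 1 : ℕ) : ℕ∞)

end ChromaticRamsey

namespace ChromaticRamsey

/-! Suppose the edge coloring is chromatic and n is large. The aim is a list of q colors whose union
needs 2^q values in every proper coloring, each color of the list doubling the requirement.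

The doubling (`DensePair.two_pow_le`): let A, B be a pair with an edge of color j between any two
ε-proportions, where each side robustly needs 2^k values for the colors in `l`. With fewer than
2^(k+1) values in all, some value is frequent on both sides, and density yields an edge of color j
inside its class. For this to survive the deletion of few vertices (`Robust`), the good pairs of
color j must cover an m-proportion of the set (`robust_cons`).

Dense pairs exist in every large set (`exists_densePair`). A color whose dense pairs cover little of
U can be stripped of all of them by deleting few vertices, and many such colors can be treated at
once (`exists_subset_avoiding`). Maximizing a potential that weighs size against the number of dense
colors therefore gives a zone all of whose large subsets are covered substantially by almost every
dense color (`exists_zone`). Nesting q zones and counting bad lists leaves a good list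
(`exists_robust_lists`).

The exponent comes from a balance: stripping costs about m r in log-size, while finding dense pairs
costs about (log r)/s with s close to ε and ε about m^(q-1). Hence m is about r^(-1/q), and each of
the q levels contributes a factor log r. -/

open Finset

/-! ### Averaging and edge counts -/

/-- Some `k`-element subset carries at least the average share of the sum. -/
theorem exists_subset_card_eq_mul_sum_le {α : Type*} [DecidableEq α] (f : α → ℝ) (k : ℕ)
    (B : Finset α) (hk : k ≤ B.card) :
    ∃ B' ⊆ B, B'.card = k ∧ (k : ℝ) * ∑ b ∈ B, f b ≤ B.card * ∑ b ∈ B', f b := by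
  induction h : B.card - k generalizing B with
  | zero => exact ⟨B, subset_rfl, by omega, by rw [show k = B.card by omega]⟩
  | succ d ih =>
    have hB : B.Nonempty := card_pos.1 (by omega)
    -- Discarding a smallest term does not lower the average.
    obtain ⟨b₀, hb₀, hmin⟩ := B.exists_min_image f hB
    have hcard := card_erase_of_mem hb₀
    obtain ⟨B', hB', hcB', hsum⟩ := ih (B.erase b₀) (by omega) (by omega)
    refine ⟨B', hB'.trans (erase_subset _ _), hcB', ?_⟩
    rcases Nat.eq_zero_or_pos k with rfl | hkpos
    · simp [card_eq_zero.1 hcB']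
    have hN : ((B.erase b₀).card : ℝ) = B.card - 1 := by
      rw [hcard, Nat.cast_sub (by omega)]; simp
    have hs : ∑ b ∈ B, f b = f b₀ + ∑ b ∈ B.erase b₀, f b := (add_sum_erase _ _ hb₀).symm
    have hm : ((B.erase b₀).card : ℝ) * f b₀ ≤ ∑ b ∈ B.erase b₀, f b := by
      have := card_nsmul_le_sum (B.erase b₀) f (f b₀) (fun x hx => hmin x (mem_of_mem_erase hx))
      simpa using this
    have hpos : (0 : ℝ) < (B.erase b₀).card := by
      have : 0 < (B.erase b₀).card := by omega
      exact_mod_cast this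
    rw [hN] at hsum hm hpos
    refine le_of_mul_le_mul_left ?_ hpos
    have hk0 : (0 : ℝ) ≤ k := by positivity
    have h1 : ((B.card : ℝ) - 1) * ∑ b ∈ B, f b ≤ B.card * ∑ b ∈ B.erase b₀, f b := by
      rw [hs]; linarith
    calc ((B.card : ℝ) - 1) * (k * ∑ b ∈ B, f b) = k * ((B.card - 1) * ∑ b ∈ B, f b) := by ring
      _ ≤ k * (B.card * ∑ b ∈ B.erase b₀, f b) := mul_le_mul_of_nonneg_left h1 hk0
      _ = B.card * (k * ∑ b ∈ B.erase b₀, f b) := by ring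
      _ ≤ B.card * ((B.card - 1) * ∑ b ∈ B', f b) :=
        mul_le_mul_of_nonneg_left hsum (by positivity)
      _ = _ := by ring

variable {V ι : Type*}

open Classical in
/-- The number of adjacent pairs in `A ×ˢ B`, as a real number. -/
noncomputable def edgeSum (H : SimpleGraph V) (A B : Finset V) : ℝ :=
  ∑ a ∈ A, ∑ b ∈ B, if H.Adj a b then 1 else 0

theorem edgeSum_nonneg (H : SimpleGraph V) (A B : Finset V) : 0 ≤ edgeSum H A B :=
  sum_nonneg fun _ _ => sum_nonneg fun _ _ => by split_ifs <;> norm_num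

theorem edgeSum_le (H : SimpleGraph V) (A B : Finset V) : edgeSum H A B ≤ A.card * B.card := by
  classical
  calc edgeSum H A B ≤ ∑ _a ∈ A, ∑ _b ∈ B, (1 : ℝ) :=
        sum_le_sum fun _ _ => sum_le_sum fun _ _ => by split_ifs <;> norm_num
    _ = A.card * B.card := by simp

theorem edgeSum_sdiff_left [DecidableEq V] (H : SimpleGraph V) {X A : Finset V} (h : X ⊆ A)
    (B : Finset V) : edgeSum H (A \ X) B + edgeSum H X B = edgeSum H A B :=
  sum_sdiff h

theorem edgeSum_sdiff_right [DecidableEq V] (H : SimpleGraph V) (A : Finset V) {Y B : Finset V}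
    (h : Y ⊆ B) : edgeSum H A (B \ Y) + edgeSum H A Y = edgeSum H A B := by
  unfold edgeSum
  rw [← sum_add_distrib]
  exact sum_congr rfl fun _ _ => sum_sdiff h

theorem edgeSum_eq_zero (H : SimpleGraph V) {X Y : Finset V}
    (h : ∀ x ∈ X, ∀ y ∈ Y, ¬ H.Adj x y) : edgeSum H X Y = 0 :=
  sum_eq_zero fun x hx => sum_eq_zero fun y hy => if_neg (h x hx y hy)

theorem exists_subset_edgeSum [DecidableEq V] (H : SimpleGraph V) (A B : Finset V) (k : ℕ)
    (hk : k ≤ B.card) :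
    ∃ B' ⊆ B, B'.card = k ∧ (k : ℝ) * edgeSum H A B ≤ B.card * edgeSum H A B' := by
  classical
  obtain ⟨B', h1, h2, h3⟩ := exists_subset_card_eq_mul_sum_le
    (fun b => ∑ a ∈ A, if H.Adj a b then (1 : ℝ) else 0) k B hk
  refine ⟨B', h1, h2, ?_⟩
  unfold edgeSum
  rwa [sum_comm, sum_comm (s := A)]

/-- In a graph family covering all pairs, some member has at least the average number of edges. -/
theorem exists_edgeSum_ge [Fintype ι] (G : ι → SimpleGraph V)
    (hG : ∀ u v, u ≠ v → ∃ i, (G i).Adj u v) {A B : Finset V} (hAB : Disjoint A B)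
    (hA : A.Nonempty) (hB : B.Nonempty) :
    ∃ i, (A.card * B.card : ℝ) ≤ Fintype.card ι * edgeSum (G i) A B := by
  classical
  have key : (A.card * B.card : ℝ) ≤ ∑ i, edgeSum (G i) A B := by
    unfold edgeSum
    rw [sum_comm]
    calc (A.card * B.card : ℝ) = ∑ _a ∈ A, ∑ _b ∈ B, (1 : ℝ) := by simp
      _ ≤ _ := by
        refine sum_le_sum fun a ha => ?_
        rw [sum_comm]
        refine sum_le_sum fun b hb => ?_
        obtain ⟨i, hi⟩ := hG a b (fun h => disjoint_left.1 hAB ha (h ▸ hb))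
        calc (1 : ℝ) = if (G i).Adj a b then 1 else 0 := by rw [if_pos hi]
          _ ≤ _ := single_le_sum (f := fun i => if (G i).Adj a b then (1 : ℝ) else 0)
            (fun _ _ => by split_ifs <;> norm_num) (mem_univ i)
  by_contra! hcon
  obtain ⟨a, ha⟩ := hA
  obtain ⟨b, hb⟩ := hB
  obtain ⟨i, -⟩ := hG a b (fun h => disjoint_left.1 hAB ha (h ▸ hb))
  have hlt := sum_lt_sum_of_nonempty (s := univ) ⟨i, mem_univ i⟩ (fun i _ => hcon i)
  have hr : (0 : ℝ) < Fintype.card ι := by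
    have : 0 < Fintype.card ι := Fintype.card_pos_iff.2 ⟨i⟩
    exact_mod_cast this
  rw [← mul_sum, sum_const, card_univ, nsmul_eq_mul] at hlt
  exact absurd (lt_of_mul_lt_mul_left hlt hr.le) (not_lt.2 key)

/-! ### Existence of dense pairs -/

/-- A disjoint balanced pair of sets of size at least `τ` such that any two subsets containing
an `ε`-proportion of the respective sides span an edge. -/
def DensePair (H : SimpleGraph V) (ε τ : ℝ) (p : Finset V × Finset V) : Prop :=
  Disjoint p.1 p.2 ∧ p.1.card = p.2.card ∧ τ ≤ p.1.card ∧
    ∀ X ⊆ p.1, ∀ Y ⊆ p.2, ε * p.1.card ≤ X.card → ε * p.2.card ≤ Y.card →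
      ∃ x ∈ X, ∃ y ∈ Y, H.Adj x y

/-- Bernoulli bounds the first term by 1 - (1-s)α, and α^(-s) ≤ ε^(-s) bounds the second. The two
terms will be the shares of the edges of a maximal pair in the rectangles left by an empty one of
relative side α, so they cannot exhaust all edges. -/
theorem rpow_density_lt_one {α ε s : ℝ} (hε : 0 < ε) (hs0 : 0 < s) (hs1 : s < 1)
    (hs : ε ^ (-s) * (1 - ε) < 1 - s) (h1 : ε ≤ α) (h2 : α < 1) :
    (1 - α) ^ (1 - s) + (1 - α) * α ^ (1 - s) < 1 := by
  have hα : 0 < α := hε.trans_le h1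
  have b1 : (1 - α) ^ (1 - s) ≤ 1 - (1 - s) * α := by
    have := rpow_one_add_le_one_add_mul_self (s := -α) (by linarith) (p := 1 - s)
      (by linarith) (by linarith)
    calc (1 - α) ^ (1 - s) = (1 + -α) ^ (1 - s) := by ring_nf
      _ ≤ _ := this
      _ = _ := by ring
  have b2 : α ^ (1 - s) ≤ α * ε ^ (-s) := by
    rw [show (1 : ℝ) - s = 1 + -s by ring, Real.rpow_add hα, Real.rpow_one]
    exact mul_le_mul_of_nonneg_left (Real.rpow_le_rpow_of_nonpos hε h1 (by linarith)) hα.le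
  have hp : 0 < ε ^ (-s) := Real.rpow_pos_of_pos hε _
  calc (1 - α) ^ (1 - s) + (1 - α) * α ^ (1 - s)
      ≤ (1 - (1 - s) * α) + (1 - ε) * (α * ε ^ (-s)) := by
        refine add_le_add b1 (mul_le_mul (by linarith) b2 (by positivity) (by linarith))
    _ = 1 - α * ((1 - s) - ε ^ (-s) * (1 - ε)) := by ring
    _ < 1 := by nlinarith [mul_pos hα (sub_pos.2 hs)]

theorem mul_rpow_mul_rpow {N z s : ℝ} (hN : 0 < N) (hz : 0 < z) :
    N * N ^ (s - 2) * z ^ (2 - s) = z * (z / N) ^ (1 - s) := by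
  rw [Real.div_rpow hz.le hN.le, show (2 : ℝ) - s = 1 + (1 - s) by ring, Real.rpow_add hz,
    show s - 2 = -(1 - s) + -1 by ring, Real.rpow_add hN, Real.rpow_neg hN.le (1 - s),
    Real.rpow_neg_one, Real.rpow_one]
  field_simp

theorem ceil_mul_le_half {ε : ℝ} (hε : ε ≤ 1 / 4) {N : ℕ} (hN : 2 ≤ N) :
    2 * ⌈ε * N⌉₊ ≤ N := by
  have h : ⌈ε * N⌉₊ ≤ N / 2 := by
    rw [Nat.ceil_le]
    have h1 : (N : ℝ) ≤ 2 * ((N / 2 : ℕ) : ℝ) + 1 := by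
      have : N ≤ 2 * (N / 2) + 1 := by omega
      exact_mod_cast this
    have h2 : (1 : ℝ) ≤ ((N / 2 : ℕ) : ℝ) := by
      have : 1 ≤ N / 2 := by omega
      exact_mod_cast this
    have h3 : (0 : ℝ) ≤ N := by positivity
    nlinarith
  omega


/-- A pair maximizing (edge density)·|A|^s over all colors and balanced pairs in `U` works.
Comparison with the majority color of a bisection of `U` bounds its size from below, losing r^(1/s);
an empty subrectangle would push the edges into two smaller rectangles, which maximality makes too
sparse. The 3 covers |U| ≤ 3⌊|U|/2⌋. -/
theorem exists_densePair [Fintype V] [DecidableEq V] [Fintype ι] (G : ι → SimpleGraph V)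
    (hG : ∀ u v, u ≠ v → ∃ i, (G i).Adj u v) {ε s : ℝ} (hε : 0 < ε) (hε' : ε ≤ 1 / 4)
    (hs0 : 0 < s) (hs1 : s < 1) (hs : ε ^ (-s) * (1 - ε) < 1 - s)
    {U : Finset V} (hU : 2 ≤ U.card) {τ : ℝ}
    (hτ : 3 * τ * (Fintype.card ι : ℝ) ^ (1 / s) ≤ U.card) :
    ∃ i, ∃ p : Finset V × Finset V, p.1 ⊆ U ∧ p.2 ⊆ U ∧ DensePair (G i) ε τ p := by
  classical
  -- a balanced bipartition of (almost all of) `U`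
  set N₀ := U.card / 2 with hN₀
  obtain ⟨A₀, hA₀, hcA₀⟩ := exists_subset_card_eq (s := U) (n := N₀) (by omega)
  obtain ⟨B₀, hB₀, hcB₀⟩ := exists_subset_card_eq (s := U \ A₀) (n := N₀)
    (by rw [card_sdiff_of_subset hA₀]; omega)
  have hN₀pos : 0 < N₀ := by omega
  have hdisj₀ : Disjoint A₀ B₀ := disjoint_sdiff.mono_right hB₀
  obtain ⟨i₀, hi₀⟩ := exists_edgeSum_ge G hG hdisj₀ (card_pos.1 (hcA₀ ▸ hN₀pos))
    (card_pos.1 (hcB₀ ▸ hN₀pos))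
  have hr : (0 : ℝ) < Fintype.card ι := by
    have : 0 < Fintype.card ι := Fintype.card_pos_iff.2 ⟨i₀⟩
    exact_mod_cast this
  let S : Finset (ι × Finset V × Finset V) := univ.filter fun t =>
    t.2.1 ⊆ U ∧ t.2.2 ⊆ U ∧ Disjoint t.2.1 t.2.2 ∧ t.2.1.card = t.2.2.card ∧ 0 < t.2.1.card
  let Φ : ι × Finset V × Finset V → ℝ := fun t =>
    edgeSum (G t.1) t.2.1 t.2.2 * (t.2.1.card : ℝ) ^ (s - 2)
  have hmem₀ : (i₀, A₀, B₀) ∈ S := by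
    simp only [S, mem_filter, mem_univ, true_and]
    exact ⟨hA₀, hB₀.trans sdiff_subset, hdisj₀, hcA₀.trans hcB₀.symm, hcA₀ ▸ hN₀pos⟩
  obtain ⟨⟨i, A, B⟩, hmem, hmax⟩ := S.exists_max_image Φ ⟨_, hmem₀⟩
  simp only [S, mem_filter, mem_univ, true_and] at hmem
  obtain ⟨hA, hB, hdisj, hcard, hpos⟩ := hmem
  have hmax' : ∀ A' B', A' ⊆ A → B' ⊆ B → A'.card = B'.card → 0 < A'.card →
      edgeSum (G i) A' B' ≤ edgeSum (G i) A B * (A.card : ℝ) ^ (s - 2) *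
        (A'.card : ℝ) ^ (2 - s) := by
    intro A' B' hA' hB' hc hp
    have hp' : (0 : ℝ) < A'.card := by exact_mod_cast hp
    have := hmax (i, A', B') (by
      simp only [S, mem_filter, mem_univ, true_and]
      exact ⟨hA'.trans hA, hB'.trans hB, hdisj.mono hA' hB', hc, hp⟩)
    simp only [Φ] at this
    calc edgeSum (G i) A' B'
        = edgeSum (G i) A' B' * (A'.card : ℝ) ^ (s - 2) * (A'.card : ℝ) ^ (2 - s) := by
          rw [mul_assoc, ← Real.rpow_add hp']; simp
      _ ≤ _ := mul_le_mul_of_nonneg_right this (by positivity)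
  have hN : (0 : ℝ) < A.card := by exact_mod_cast hpos
  have hN₀' : (0 : ℝ) < N₀ := by exact_mod_cast hN₀pos
  have hΦ₀ : (N₀ : ℝ) ^ s ≤ Fintype.card ι * Φ (i, A, B) := by
    have h1 : (N₀ : ℝ) ^ s ≤ Fintype.card ι * Φ (i₀, A₀, B₀) := by
      simp only [Φ]
      rw [hcA₀, hcB₀] at hi₀
      rw [hcA₀, ← mul_assoc]
      calc (N₀ : ℝ) ^ s = N₀ * N₀ * (N₀ : ℝ) ^ (s - 2) := by
            rw [Real.rpow_sub hN₀', Real.rpow_two]; field_simp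
        _ ≤ _ := mul_le_mul_of_nonneg_right hi₀ (by positivity)
    exact h1.trans (mul_le_mul_of_nonneg_left (hmax _ hmem₀) hr.le)
  have hepos : 0 < edgeSum (G i) A B := by
    have h1 : 0 < Φ (i, A, B) :=
      pos_of_mul_pos_right (lt_of_lt_of_le (by positivity) hΦ₀) hr.le
    exact pos_of_mul_pos_left h1 (by positivity)
  refine ⟨i, (A, B), hA, hB, hdisj, hcard, ?_, ?_⟩
  · -- size of the pair
    have h1 : Φ (i, A, B) ≤ (A.card : ℝ) ^ s := by
      simp only [Φ]
      have := edgeSum_le (G i) A B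
      rw [← hcard] at this
      calc _ ≤ (A.card * A.card : ℝ) * (A.card : ℝ) ^ (s - 2) :=
            mul_le_mul_of_nonneg_right this (by positivity)
        _ = _ := by rw [Real.rpow_sub hN, Real.rpow_two]; field_simp
    have h2 : (N₀ : ℝ) ^ s ≤ Fintype.card ι * (A.card : ℝ) ^ s :=
      hΦ₀.trans (mul_le_mul_of_nonneg_left h1 hr.le)
    have h3 : (N₀ : ℝ) ≤ (Fintype.card ι : ℝ) ^ (1 / s) * A.card := by
      have := Real.rpow_le_rpow (by positivity) h2 (z := 1 / s) (by positivity)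
      rwa [Real.mul_rpow hr.le (by positivity), ← Real.rpow_mul hN.le, ← Real.rpow_mul hN₀'.le,
        mul_one_div_cancel hs0.ne', Real.rpow_one, Real.rpow_one] at this
    have h4 : (U.card : ℝ) ≤ 3 * N₀ := by
      have : U.card ≤ 3 * N₀ := by omega
      exact_mod_cast this
    have h5 : (0 : ℝ) < (Fintype.card ι : ℝ) ^ (1 / s) := by positivity
    show τ ≤ A.card
    refine le_of_mul_le_mul_right ?_ h5
    linarith
  · -- density of the pair
    intro X hX Y hY hXc hYc
    simp only at hX hY hXc hYc
    rw [← hcard] at hYc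
    by_contra! hcon
    -- Both subsets are cut to one size `x`, so that `X'` can be compared with balanced pairs.
    set x := ⌈ε * A.card⌉₊ with hx
    have hxpos : 0 < x := Nat.ceil_pos.2 (by positivity)
    obtain ⟨X', hX', hcX'⟩ := exists_subset_card_eq (s := X) (n := x) (Nat.ceil_le.2 hXc)
    obtain ⟨Y', hY', hcY'⟩ := exists_subset_card_eq (s := Y) (n := x) (Nat.ceil_le.2 hYc)
    have hzero : edgeSum (G i) X' Y' = 0 :=
      edgeSum_eq_zero _ fun a ha b hb => hcon a (hX' ha) b (hY' hb)
    have hXA := hX'.trans hX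
    have hYB := hY'.trans hY
    have hxle : x ≤ A.card := hcX' ▸ card_le_card hXA
    have hsplit : edgeSum (G i) A B = edgeSum (G i) (A \ X') B + edgeSum (G i) X' (B \ Y') := by
      rw [← edgeSum_sdiff_left (G i) hXA B, ← edgeSum_sdiff_right (G i) X' hYB, hzero, add_zero]
    -- Singletons are separate: there `x` is all of |A| and `x` ≤ |A|/2 fails, but the empty
    -- rectangle is then the whole pair.
    rcases Nat.lt_or_ge A.card 2 with hN1 | hN2
    · have hA1 : X' = A := eq_of_subset_of_card_le hXA (by omega)
      have hB1 : Y' = B := eq_of_subset_of_card_le hYB (by omega)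
      rw [hA1, hB1] at hzero
      exact hepos.ne' hzero
    have hhalf := ceil_mul_le_half hε' hN2
    rw [← hx] at hhalf
    have hcAX : (A \ X').card = A.card - x := by rw [card_sdiff_of_subset hXA, hcX']
    have hcBY : (B \ Y').card = A.card - x := by rw [card_sdiff_of_subset hYB, hcY', hcard]
    -- Each remaining rectangle is unbalanced. Averaging trims its longer side without losing
    -- density, after which maximality applies.
    obtain ⟨B₁, hB₁, hcB₁, he₁⟩ := exists_subset_edgeSum (G i) (A \ X') B (A.card - x) (by omega)
    obtain ⟨B₂, hB₂, hcB₂, he₂⟩ := exists_subset_edgeSum (G i) X' (B \ Y') x (by omega)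
    have hm₁ := hmax' (A \ X') B₁ sdiff_subset hB₁ (by omega) (by omega)
    have hm₂ := hmax' X' B₂ hXA (hB₂.trans sdiff_subset) (by omega) (by omega)
    have hcast : ((A.card - x : ℕ) : ℝ) = A.card - x := Nat.cast_sub hxle
    rw [hcAX, hcast] at hm₁
    rw [hcX'] at hm₂
    rw [hcast, ← hcard] at he₁
    rw [hcBY, hcast] at he₂
    have hx0 : (0 : ℝ) < x := by exact_mod_cast hxpos
    have hxN : (2 : ℝ) * x ≤ A.card := by exact_mod_cast hhalf
    have hεx : ε * A.card ≤ x := Nat.le_ceil _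
    generalize edgeSum (G i) A B = e at *
    generalize edgeSum (G i) (A \ X') B = e₁ at *
    generalize edgeSum (G i) X' (B \ Y') = e₂ at *
    generalize (A.card : ℝ) = N at *
    generalize (x : ℝ) = y at *
    have hd : 0 < N - y := by linarith
    have k₁ : e₁ ≤ e * (1 - y / N) ^ (1 - s) := by
      refine le_of_mul_le_mul_left ?_ hd
      calc (N - y) * e₁ ≤ N * (e * N ^ (s - 2) * (N - y) ^ (2 - s)) :=
            he₁.trans (mul_le_mul_of_nonneg_left hm₁ hN.le)
        _ = e * (N * N ^ (s - 2) * (N - y) ^ (2 - s)) := by ring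
        _ = (N - y) * (e * (1 - y / N) ^ (1 - s)) := by
          rw [mul_rpow_mul_rpow hN hd, one_sub_div hN.ne']; ring
    have k₂ : e₂ ≤ e * ((1 - y / N) * (y / N) ^ (1 - s)) := by
      refine le_of_mul_le_mul_left ?_ hx0
      calc y * e₂ ≤ (N - y) * (e * N ^ (s - 2) * y ^ (2 - s)) :=
            he₂.trans (mul_le_mul_of_nonneg_left hm₂ hd.le)
        _ = (N - y) / N * e * (N * N ^ (s - 2) * y ^ (2 - s)) := by field_simp
        _ = y * (e * ((1 - y / N) * (y / N) ^ (1 - s))) := by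
          rw [mul_rpow_mul_rpow hN hx0, one_sub_div hN.ne']; ring
    have k₃ := rpow_density_lt_one (α := y / N) hε hs0 hs1 hs (by rwa [le_div_iff₀ hN])
      (by rw [div_lt_one hN]; linarith)
    nlinarith

/-! ### Heavy colors and zones -/

/-- `U` contains disjoint dense pairs of `H` covering an `m`-proportion of its vertices. -/
def Heavy [DecidableEq V] (H : SimpleGraph V) (ε τ m : ℝ) (U : Finset V) : Prop :=
  ∃ F : Finset (Finset V × Finset V),
    (∀ p ∈ F, p.1 ⊆ U ∧ p.2 ⊆ U ∧ DensePair H ε τ p) ∧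
    (F : Set (Finset V × Finset V)).PairwiseDisjoint (fun p => p.1 ∪ p.2) ∧
    m * U.card ≤ ∑ p ∈ F, ((p.1 ∪ p.2).card : ℝ)

/-- `Z` is the union of a disjoint family of dense pairs with maximal total size. A dense pair
avoiding `Z` could be added, and it is nonempty because τ > 0. -/
theorem exists_sdiff_no_densePair [Fintype V] [DecidableEq V] {H : SimpleGraph V} {ε τ m : ℝ}
    (hτ : 0 < τ) {U : Finset V} (h : ¬ Heavy H ε τ m U) :
    ∃ Z : Finset V, (Z.card : ℝ) ≤ m * U.card ∧
      ∀ p : Finset V × Finset V, p.1 ⊆ U \ Z → p.2 ⊆ U \ Z → ¬ DensePair H ε τ p := by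
  classical
  let S : Finset (Finset (Finset V × Finset V)) := univ.filter fun F =>
    (∀ p ∈ F, p.1 ⊆ U ∧ p.2 ⊆ U ∧ DensePair H ε τ p) ∧
    (F : Set (Finset V × Finset V)).PairwiseDisjoint (fun p => p.1 ∪ p.2)
  obtain ⟨F, hF, hmax⟩ := S.exists_max_image (fun F => ∑ p ∈ F, (p.1 ∪ p.2).card)
    ⟨∅, by simp [S]⟩
  simp only [S, mem_filter, mem_univ, true_and] at hF hmax
  obtain ⟨hF1, hF2⟩ := hF
  refine ⟨F.biUnion fun p => p.1 ∪ p.2, ?_, ?_⟩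
  · by_contra! hlt
    refine h ⟨F, hF1, hF2, ?_⟩
    rw [card_biUnion hF2] at hlt
    push_cast at hlt
    exact hlt.le
  · intro p hp1 hp2 hp
    have hne : p.1.Nonempty := by
      have : (0 : ℝ) < p.1.card := hτ.trans_le hp.2.2.1
      exact card_pos.1 (by exact_mod_cast this)
    have hdis : ∀ p' ∈ F, Disjoint (p.1 ∪ p.2) (p'.1 ∪ p'.2) := by
      intro p' hp'
      refine disjoint_left.2 fun v hv hv' => ?_
      exact (mem_sdiff.1 (union_subset hp1 hp2 hv)).2 (mem_biUnion.2 ⟨p', hp', hv'⟩)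
    have hnot : p ∉ F := fun hpF => by
      obtain ⟨v, hv⟩ := hne
      have := disjoint_left.1 (hdis p hpF) (mem_union_left _ hv)
      exact this (mem_union_left _ hv)
    have := hmax (insert p F) ⟨?_, ?_⟩
    · rw [sum_insert hnot] at this
      have h0 : 0 < (p.1 ∪ p.2).card := card_pos.2 (hne.mono subset_union_left)
      omega
    · intro p' hp'
      rcases mem_insert.1 hp' with rfl | hp'
      · exact ⟨hp1.trans sdiff_subset, hp2.trans sdiff_subset, hp⟩
      · exact hF1 p' hp'
    · rw [coe_insert]
      exact hF2.insert fun p' hp' _ => hdis p' hp'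

/-- Small sets can be avoided, many at a time, on a set that is not too small. -/
theorem exists_subset_avoiding [DecidableEq V] [DecidableEq ι] (J : Finset ι) (Z : ι → Finset V)
    (U : Finset V) {m : ℝ} (hm : m ≤ 1 / 8)
    (hZ : ∀ j ∈ J, ((Z j).card : ℝ) ≤ m * U.card) :
    ∃ J' ⊆ J, J.card ≤ 2 * J'.card ∧ ∃ W ⊆ U, (∀ j ∈ J', Disjoint W (Z j)) ∧
      (1 - 4 * m) ^ J.card * U.card / 2 ≤ W.card := by
  rcases J.eq_empty_or_nonempty with rfl | hJ
  · exact ⟨∅, subset_rfl, by simp, U, subset_rfl, by simp, by simp⟩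
  rcases U.eq_empty_or_nonempty with rfl | hU
  · exact ⟨J, subset_rfl, by omega, ∅, subset_rfl, by simp, by simp⟩
  have hU0 : (0 : ℝ) < U.card := by exact_mod_cast hU.card_pos
  have hJ0 : (0 : ℝ) < J.card := by exact_mod_cast hJ.card_pos
  have hm0 : 0 ≤ m := by
    obtain ⟨j, hj⟩ := hJ
    have := (Nat.cast_nonneg (α := ℝ) _).trans (hZ j hj)
    exact nonneg_of_mul_nonneg_left this hU0
  -- vertices lying in few of the sets
  let e : Finset ι → V → ℝ := fun I v => ((I.filter fun j => v ∈ Z j).card : ℝ)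
  have hdouble : ∀ (I : Finset ι) (W : Finset V),
      ∑ v ∈ W, e I v = ∑ j ∈ I, ((W ∩ Z j).card : ℝ) := by
    intro I W
    simp only [e, card_filter, Nat.cast_sum]
    rw [sum_comm]
    refine sum_congr rfl fun j _ => ?_
    rw [← Nat.cast_sum, ← card_filter, filter_mem_eq_inter]
  -- A vertex lies in at most m|J| of the sets on average, so by Markov `U₀` keeps at least half of
  -- `U`.
  set U₀ := U.filter fun v => e J v ≤ 2 * m * J.card with hU₀
  have hU₀card : (U.card : ℝ) / 2 ≤ U₀.card := by
    by_contra! hlt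
    have hsplit : ((U \ U₀).card : ℝ) + U₀.card = U.card := by
      exact_mod_cast card_sdiff_add_card_eq_card (filter_subset _ _)
    have hne : (U \ U₀).Nonempty := by
      have : (0 : ℝ) < (U \ U₀).card := by linarith
      exact card_pos.1 (by exact_mod_cast this)
    have h1 : ∑ _v ∈ U \ U₀, 2 * m * (J.card : ℝ) < ∑ v ∈ U \ U₀, e J v := by
      refine sum_lt_sum_of_nonempty hne fun v hv => ?_
      by_contra! hle
      exact (mem_sdiff.1 hv).2 (mem_filter.2 ⟨(mem_sdiff.1 hv).1, hle⟩)
    have h2 : ∑ v ∈ U \ U₀, e J v ≤ ∑ v ∈ U, e J v :=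
      sum_le_sum_of_subset_of_nonneg sdiff_subset fun _ _ _ => by positivity
    have h3 : ∑ v ∈ U, e J v ≤ ∑ _j ∈ J, m * U.card := by
      rw [hdouble]
      refine sum_le_sum fun j hj => le_trans ?_ (hZ j hj)
      exact_mod_cast card_le_card inter_subset_right
    rw [sum_const, nsmul_eq_mul] at h1 h3
    nlinarith [mul_nonneg hm0 hJ0.le]
  -- Greedy choice: before each choice at least half of `J` is unused, so inside `U₀` some unused
  -- set meets `W` in at most a 4m-proportion. Removing it costs a factor 1 - 4m.
  have hstep : ∀ i : ℕ, 2 * i ≤ J.card + 1 → ∃ J' ⊆ J, J'.card = i ∧ ∃ W ⊆ U₀,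
      (∀ j ∈ J', Disjoint W (Z j)) ∧ (1 - 4 * m) ^ i * U₀.card ≤ W.card := by
    intro i
    induction i with
    | zero => exact fun _ => ⟨∅, by simp, rfl, U₀, subset_rfl, by simp, by simp⟩
    | succ i ih =>
      intro hi
      obtain ⟨J', hJ', hcJ', W, hW, hWd, hWc⟩ := ih (by omega)
      have hcs : (J \ J').card = J.card - i := by rw [card_sdiff_of_subset hJ', hcJ']
      have hne : (J \ J').Nonempty := card_pos.1 (by omega)
      have hhalf : (J.card : ℝ) ≤ 2 * (J \ J').card := by
        have : J.card ≤ 2 * (J \ J').card := by omega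
        exact_mod_cast this
      obtain ⟨j, hj, hjc⟩ : ∃ j ∈ J \ J', ((W ∩ Z j).card : ℝ) ≤ 4 * m * W.card := by
        by_contra! hcon
        have h1 := sum_lt_sum_of_nonempty hne hcon
        rw [← hdouble, sum_const, nsmul_eq_mul] at h1
        have h2 : ∑ v ∈ W, e (J \ J') v ≤ ∑ _v ∈ W, 2 * m * J.card := by
          refine sum_le_sum fun v hv => ?_
          refine le_trans ?_ (mem_filter.1 (hW hv)).2
          simp only [e]
          exact_mod_cast card_le_card (filter_subset_filter _ sdiff_subset)
        rw [sum_const, nsmul_eq_mul] at h2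
        have hw : (0 : ℝ) ≤ m * W.card := by positivity
        nlinarith
      have hj' := mem_sdiff.1 hj
      refine ⟨insert j J', insert_subset hj'.1 hJ', by rw [card_insert_of_notMem hj'.2, hcJ'],
        W \ Z j, sdiff_subset.trans hW, ?_, ?_⟩
      · intro j' hj'
        rcases mem_insert.1 hj' with rfl | hj'
        · exact sdiff_disjoint
        · exact (hWd j' hj').mono_left sdiff_subset
      · have h1 : ((W \ Z j).card : ℝ) = W.card - (W ∩ Z j).card := by
          rw [← card_sdiff_add_card_inter W (Z j)]; push_cast; ring
        rw [h1, pow_succ]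
        nlinarith [mul_le_mul_of_nonneg_left hWc (show 0 ≤ 1 - 4 * m by linarith)]
  obtain ⟨J', hJ', hcJ', W, hW, hWd, hWc⟩ := hstep ((J.card + 1) / 2) (by omega)
  refine ⟨J', hJ', by omega, W, hW.trans (filter_subset _ _), hWd, ?_⟩
  have hp : (1 - 4 * m) ^ J.card ≤ (1 - 4 * m) ^ ((J.card + 1) / 2) :=
    pow_le_pow_of_le_one (by linarith) (by linarith) (by have := hJ.card_pos; omega)
  have hp0 : 0 ≤ (1 - 4 * m) ^ ((J.card + 1) / 2) := pow_nonneg (by linarith) _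
  calc (1 - 4 * m) ^ J.card * U.card / 2 = (1 - 4 * m) ^ J.card * (U.card / 2) := by ring
    _ ≤ (1 - 4 * m) ^ ((J.card + 1) / 2) * U₀.card :=
      mul_le_mul hp hU₀card (by positivity) hp0
    _ ≤ _ := hWc

open Classical in
/-- The colors having a dense pair inside `U`. -/
noncomputable def denseColors [Fintype ι] (G : ι → SimpleGraph V) (ε τ : ℝ) (U : Finset V) :
    Finset ι :=
  univ.filter fun i => ∃ p : Finset V × Finset V, p.1 ⊆ U ∧ p.2 ⊆ U ∧ DensePair (G i) ε τ p

theorem denseColors_mono [Fintype ι] (G : ι → SimpleGraph V) (ε τ : ℝ) {W U : Finset V}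
    (h : W ⊆ U) : denseColors G ε τ W ⊆ denseColors G ε τ U := by
  classical
  intro i hi
  simp only [denseColors, mem_filter, mem_univ, true_and] at hi ⊢
  obtain ⟨p, h1, h2, h3⟩ := hi
  exact ⟨p, h1.trans h, h2.trans h, h3⟩

open Classical in
/-- If many of the dense colors of a superset are not heavy in `U`, then a large subset of `U` loses
many of them. -/
theorem exists_subset_card_denseColors_le [Fintype V] [DecidableEq V] [Fintype ι]
    (G : ι → SimpleGraph V) {ε τ m γ : ℝ} (hτ : 0 < τ) (hm0 : 0 ≤ m) (hm : m ≤ 1 / 8)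
    {U' U : Finset V} (hU : U' ⊆ U)
    (h : γ * (denseColors G ε τ U).card <
      ((denseColors G ε τ U).filter fun i => ¬ Heavy (G i) ε τ m U').card) :
    ∃ W ⊆ U', Real.exp (-(8 * m * Fintype.card ι)) * U'.card / 2 ≤ W.card ∧
      ((denseColors G ε τ W).card : ℝ) ≤ (1 - γ / 2) * (denseColors G ε τ U).card := by
  set T := denseColors G ε τ U
  set J := T.filter fun i => ¬ Heavy (G i) ε τ m U'
  have hex : ∀ j, ∃ Z : Finset V, j ∈ J → (Z.card : ℝ) ≤ m * U'.card ∧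
      ∀ p : Finset V × Finset V, p.1 ⊆ U' \ Z → p.2 ⊆ U' \ Z → ¬ DensePair (G j) ε τ p := by
    intro j
    by_cases hj : j ∈ J
    · obtain ⟨Z, hZ⟩ := exists_sdiff_no_densePair hτ (mem_filter.1 hj).2
      exact ⟨Z, fun _ => hZ⟩
    · exact ⟨∅, fun h => absurd h hj⟩
  choose Z hZ using hex
  obtain ⟨J', hJ', hcJ', W, hW, hWd, hWc⟩ := exists_subset_avoiding J Z U' hm
    fun j hj => (hZ j hj).1
  refine ⟨W, hW, le_trans ?_ hWc, ?_⟩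
  · have h1 : Real.exp (-(8 * m)) ≤ 1 - 4 * m := by
      have h2 : Real.exp (-(8 * m)) * (1 + 8 * m) ≤ 1 := by
        calc _ ≤ Real.exp (-(8 * m)) * Real.exp (8 * m) :=
              mul_le_mul_of_nonneg_left (by linarith [Real.add_one_le_exp (8 * m)]) (by positivity)
          _ = 1 := by rw [← Real.exp_add]; simp
      rw [← le_div_iff₀ (by positivity)] at h2
      refine h2.trans ?_
      rw [div_le_iff₀ (by positivity)]
      nlinarith
    have h2 : Real.exp (-(8 * m * Fintype.card ι)) ≤ (1 - 4 * m) ^ J.card := by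
      calc Real.exp (-(8 * m * Fintype.card ι)) = Real.exp (-(8 * m)) ^ Fintype.card ι := by
            rw [← Real.exp_nat_mul]; ring_nf
        _ ≤ (1 - 4 * m) ^ Fintype.card ι := pow_le_pow_left₀ (by positivity) h1 _
        _ ≤ _ := pow_le_pow_of_le_one (by linarith) (by linarith) (card_le_univ J)
    have : (0 : ℝ) ≤ U'.card := by positivity
    have := mul_le_mul_of_nonneg_right h2 this
    linarith
  · have hsub : denseColors G ε τ W ⊆ T \ J' := by
      intro i hi
      refine mem_sdiff.2 ⟨denseColors_mono G ε τ (hW.trans hU) hi, fun hiJ => ?_⟩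
      simp only [denseColors, mem_filter, mem_univ, true_and] at hi
      obtain ⟨p, h1, h2, h3⟩ := hi
      have hWZ : W ⊆ U' \ Z i := fun v hv =>
        mem_sdiff.2 ⟨hW hv, disjoint_left.1 (hWd i hiJ) hv⟩
      exact (hZ i (hJ' hiJ)).2 p (h1.trans hWZ) (h2.trans hWZ) h3
    have h1 : ((denseColors G ε τ W).card : ℝ) ≤ T.card - J'.card := by
      have h2 := card_le_card hsub
      have h3 : (T \ J').card + J'.card = T.card :=
        card_sdiff_add_card_eq_card (hJ'.trans (filter_subset _ _))
      have h4 : ((T \ J').card : ℝ) + J'.card = T.card := by exact_mod_cast h3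
      have h5 : ((denseColors G ε τ W).card : ℝ) ≤ (T \ J').card := by exact_mod_cast h2
      linarith
    have h2 : (J.card : ℝ) ≤ 2 * J'.card := by exact_mod_cast hcJ'
    linarith

open Classical in
/-- Inside any large set there is a set `U`, not much smaller, all of whose large subsets are covered
substantially by dense pairs of almost every dense color of `U`. -/
theorem exists_zone [Fintype V] [DecidableEq V] [Fintype ι] [Nonempty ι] (G : ι → SimpleGraph V)
    (hG : ∀ u v, u ≠ v → ∃ i, (G i).Adj u v) {ε s : ℝ} (hε : 0 < ε) (hε' : ε ≤ 1 / 4)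
    (hs0 : 0 < s) (hs1 : s < 1) (hs : ε ^ (-s) * (1 - ε) < 1 - s)
    {τ m γ D lam : ℝ} (hτ : 1 ≤ τ) (hm0 : 0 ≤ m) (hm : m ≤ 1 / 8) (hγ0 : 0 < γ)
    (hD : 0 ≤ D) (hlam : D + 8 * m * Fintype.card ι + 1 ≤ lam * (γ / 2)) {U₀ : Finset V}
    (hU₀ : 3 * τ * (Fintype.card ι : ℝ) ^ (1 / s) ≤
      Real.exp (-(8 * m * Fintype.card ι + D + 1)) *
        ((Fintype.card ι : ℝ) ^ (-lam) * U₀.card)) :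
    ∃ U ⊆ U₀, (Fintype.card ι : ℝ) ^ (-lam) * U₀.card ≤ U.card ∧
      (denseColors G ε τ U).Nonempty ∧
      ∀ U' ⊆ U, Real.exp (-D) * U.card ≤ U'.card →
        (((denseColors G ε τ U).filter fun i => ¬ Heavy (G i) ε τ m U').card : ℝ) ≤
          γ * (denseColors G ε τ U).card := by
  have hr1 : (1 : ℝ) ≤ Fintype.card ι := by
    have : 1 ≤ Fintype.card ι := Fintype.card_pos
    exact_mod_cast this
  set r : ℝ := (Fintype.card ι : ℝ)
  have hr0 : 0 < r := by linarith
  have hmr : 0 ≤ 8 * m * r := by positivity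
  have hlam0 : 0 ≤ lam := by
    by_contra! hneg
    have := mul_neg_of_neg_of_pos hneg (half_pos hγ0)
    linarith
  have hω1 : 1 ≤ r ^ (1 / s) := Real.one_le_rpow hr1 (by positivity)
  have hω3 : 3 ≤ 3 * τ * r ^ (1 / s) := by nlinarith
  have hne : ∀ W : Finset V, 3 * τ * r ^ (1 / s) ≤ W.card → (denseColors G ε τ W).Nonempty := by
    intro W hW
    have h2 : 2 ≤ W.card := by
      have : (2 : ℝ) ≤ W.card := by linarith
      exact_mod_cast this
    obtain ⟨i, p, h1, h2, h3⟩ := exists_densePair G hG hε hε' hs0 hs1 hs h2 hW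
    exact ⟨i, by simpa only [denseColors, mem_filter, mem_univ, true_and] using ⟨p, h1, h2, h3⟩⟩
  have hU₀' : 3 * τ * r ^ (1 / s) ≤ U₀.card := by
    refine hU₀.trans ?_
    have h1 : Real.exp (-(8 * m * r + D + 1)) ≤ 1 := by
      rw [Real.exp_le_one_iff]; linarith
    have h2 : r ^ (-lam) ≤ 1 := Real.rpow_le_one_of_one_le_of_nonpos hr1 (by linarith)
    calc _ ≤ 1 * (1 * (U₀.card : ℝ)) := by gcongr
      _ = _ := by ring
  let S := U₀.powerset.filter fun U => (denseColors G ε τ U).Nonempty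
  -- The exponent λ sets the price of a color: a set may shrink if it loses enough dense colors in
  -- return.
  let Ψ : Finset V → ℝ := fun U => U.card * ((denseColors G ε τ U).card : ℝ) ^ (-lam)
  obtain ⟨U, hUS, hmax⟩ := S.exists_max_image Ψ
    ⟨U₀, mem_filter.2 ⟨mem_powerset_self _, hne _ hU₀'⟩⟩
  obtain ⟨hU, hUne⟩ := mem_filter.1 hUS
  rw [mem_powerset] at hU
  have hT1 : (1 : ℝ) ≤ (denseColors G ε τ U).card := by
    exact_mod_cast hUne.card_pos
  have hsize : r ^ (-lam) * U₀.card ≤ U.card := by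
    have h1 : Ψ U₀ ≤ Ψ U := hmax _ (mem_filter.2 ⟨mem_powerset_self _, hne _ hU₀'⟩)
    have h2 : r ^ (-lam) ≤ ((denseColors G ε τ U₀).card : ℝ) ^ (-lam) := by
      refine Real.rpow_le_rpow_of_nonpos ?_ ?_ (by linarith)
      · exact_mod_cast (hne _ hU₀').card_pos
      · exact Nat.cast_le.2 (card_le_univ _)
    have h3 : ((denseColors G ε τ U).card : ℝ) ^ (-lam) ≤ 1 :=
      Real.rpow_le_one_of_one_le_of_nonpos hT1 (by linarith)
    calc r ^ (-lam) * U₀.card ≤ Ψ U₀ := by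
          simp only [Ψ]; rw [mul_comm]; gcongr
      _ ≤ Ψ U := h1
      _ ≤ U.card * 1 := by simp only [Ψ]; gcongr
      _ = U.card := mul_one _
  refine ⟨U, hU, hsize, hUne, fun U' hU' hc => ?_⟩
  by_contra! hlt
  -- A violating `U'` would yield `W` smaller than `U` by a factor of at most 2·exp(8mr + D), but
  -- with a gain of exp(λγ/2) ≥ exp(D + 8mr + 1) from the lost colors. Since e > 2, this beats the
  -- maximum.
  obtain ⟨W, hW, hWc, hWT⟩ := exists_subset_card_denseColors_le G (by linarith) hm0 hm hU' hlt
  change Real.exp (-(8 * m * r)) * U'.card / 2 ≤ W.card at hWc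
  have he2 : (2 : ℝ) < Real.exp 1 := by
    have := Real.add_one_lt_exp (x := 1) one_ne_zero
    linarith
  have hUpos : (0 : ℝ) < U.card := by
    have h0 : 0 < r ^ (-lam) * U₀.card := by
      have : (0 : ℝ) < U₀.card := by linarith
      positivity
    linarith
  have hWU : Real.exp (-(8 * m * r + D)) * U.card ≤ 2 * W.card := by
    have : Real.exp (-(8 * m * r)) * (Real.exp (-D) * U.card) ≤ Real.exp (-(8 * m * r)) * U'.card :=
      mul_le_mul_of_nonneg_left hc (by positivity)
    rw [← mul_assoc, ← Real.exp_add, ← neg_add] at this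
    linarith
  -- `W` is still large enough to have a dense color, so it competes in the maximum and the negative
  -- power stays meaningful.
  have hWω : 3 * τ * r ^ (1 / s) ≤ W.card := by
    have h1 : Real.exp (-(8 * m * r + D + 1)) * 2 ≤ Real.exp (-(8 * m * r + D)) := by
      calc _ ≤ Real.exp (-(8 * m * r + D + 1)) * Real.exp 1 := by gcongr
        _ = _ := by rw [← Real.exp_add]; ring_nf
    have h2 : Real.exp (-(8 * m * r + D + 1)) * (r ^ (-lam) * U₀.card) ≤
        Real.exp (-(8 * m * r + D + 1)) * U.card := by gcongr
    have h3 : Real.exp (-(8 * m * r + D + 1)) * 2 * U.card ≤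
        Real.exp (-(8 * m * r + D)) * U.card := by gcongr
    linarith
  have hWne := hne W hWω
  have hΨ : Ψ W ≤ Ψ U := hmax _ (mem_filter.2 ⟨mem_powerset.2 (hW.trans (hU'.trans hU)), hWne⟩)
  have hWT0 : (0 : ℝ) < (denseColors G ε τ W).card := by exact_mod_cast hWne.card_pos
  have hexp : Real.exp (lam * (γ / 2)) * ((denseColors G ε τ U).card : ℝ) ^ (-lam) ≤
      ((denseColors G ε τ W).card : ℝ) ^ (-lam) := by
    have h1 : ((denseColors G ε τ W).card : ℝ) ≤
        Real.exp (-(γ / 2)) * (denseColors G ε τ U).card := by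
      refine hWT.trans (mul_le_mul_of_nonneg_right ?_ (by positivity))
      linarith [Real.add_one_le_exp (-(γ / 2))]
    have h2 := Real.rpow_le_rpow_of_nonpos hWT0 h1 (z := -lam) (by linarith)
    rw [Real.mul_rpow (by positivity) (by positivity), ← Real.exp_mul] at h2
    convert h2 using 2
    ring_nf
  have hfin : Real.exp (lam * (γ / 2)) * W.card ≤ U.card := by
    have hp : 0 < ((denseColors G ε τ U).card : ℝ) ^ (-lam) := by positivity
    refine le_of_mul_le_mul_right ?_ hp
    calc _ = W.card * (Real.exp (lam * (γ / 2)) * ((denseColors G ε τ U).card : ℝ) ^ (-lam)) := by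
          ring
      _ ≤ Ψ W := by simp only [Ψ]; gcongr
      _ ≤ Ψ U := hΨ
  have h1 : Real.exp (D + 8 * m * r + 1) * (Real.exp (-(8 * m * r + D)) * U.card) ≤ 2 * U.card := by
    calc _ ≤ Real.exp (lam * (γ / 2)) * (2 * W.card) := by gcongr
      _ ≤ _ := by linarith
  rw [← mul_assoc, ← Real.exp_add] at h1
  ring_nf at h1
  nlinarith

/-! ### Robust lists and the doubling step -/

/-- Every proper coloring of the union of the graphs listed in `l`, on a subset of `U` missing at
most an `η`-proportion, uses at least `2 ^ l.length` values. -/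
def Robust [DecidableEq V] (G : ι → SimpleGraph V) (l : List ι) (η : ℝ) (U : Finset V) : Prop :=
  ∀ W ⊆ U, ((U \ W).card : ℝ) ≤ η * U.card → ∀ f : V → ℕ,
    (∀ u ∈ W, ∀ v ∈ W, ∀ i ∈ l, (G i).Adj u v → f u ≠ f v) → 2 ^ l.length ≤ (W.image f).card

theorem robust_nil [DecidableEq V] (G : ι → SimpleGraph V) {η : ℝ} (hη : η < 1) {U : Finset V}
    (hU : U.Nonempty) : Robust G [] η U := by
  intro W hW hc f _
  have hU0 : (0 : ℝ) < U.card := by exact_mod_cast hU.card_pos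
  have hne : W.Nonempty := by
    rw [nonempty_iff_ne_empty]
    rintro rfl
    rw [sdiff_empty] at hc
    nlinarith
  simpa using card_pos.2 (hne.image f)

/-- In a robust set, many values of a proper coloring are taken often. -/
theorem Robust.card_heavy_values [DecidableEq V] {G : ι → SimpleGraph V} {l : List ι} {η ε : ℝ}
    {A : Finset V} (hA : Robust G l η A) {W : Finset V} {f : V → ℕ} {M : ℕ} (hε : 0 ≤ ε)
    (hεM : ε * M ≤ η / 2) (hM : (W.image f).card ≤ M)
    (hW : ((A \ W).card : ℝ) ≤ η / 2 * A.card)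
    (hf : ∀ u ∈ W, ∀ v ∈ W, ∀ i ∈ l, (G i).Adj u v → f u ≠ f v) :
    2 ^ l.length ≤ ((W.image f).filter fun c =>
      ε * A.card ≤ (((A ∩ W).filter fun v => f v = c).card : ℝ)).card := by
  classical
  set C := (W.image f).filter fun c => ε * A.card ≤ (((A ∩ W).filter fun v => f v = c).card : ℝ)
  -- Dropping the rare values costs at most M·ε|A| ≤ (η/2)|A| vertices. Together with the part
  -- outside `W` this is within the tolerance η, so robustness applies to `X`, which sees only
  -- frequent values.
  set X := (A ∩ W).filter fun v => f v ∈ C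
  have hXW : X ⊆ W := (filter_subset _ _).trans inter_subset_right
  have hXA : X ⊆ A := (filter_subset _ _).trans inter_subset_left
  have himg : X.image f ⊆ C := by
    intro c hc
    obtain ⟨v, hv, rfl⟩ := mem_image.1 hc
    exact (mem_filter.1 hv).2
  refine le_trans (hA X hXA ?_ f fun u hu v hv => hf u (hXW hu) v (hXW hv)) (card_le_card himg)
  have hsub : A \ X ⊆ (A \ W) ∪ ((W.image f) \ C).biUnion fun c =>
      (A ∩ W).filter fun v => f v = c := by
    intro v hv
    obtain ⟨hvA, hvX⟩ := mem_sdiff.1 hv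
    by_cases hvW : v ∈ W
    · refine mem_union_right _ (mem_biUnion.2 ⟨f v, mem_sdiff.2 ⟨mem_image_of_mem f hvW, ?_⟩, ?_⟩)
      · exact fun h => hvX (mem_filter.2 ⟨mem_inter.2 ⟨hvA, hvW⟩, h⟩)
      · exact mem_filter.2 ⟨mem_inter.2 ⟨hvA, hvW⟩, rfl⟩
    · exact mem_union_left _ (mem_sdiff.2 ⟨hvA, hvW⟩)
  have h1 : ((A \ X).card : ℝ) ≤ (A \ W).card +
      ∑ c ∈ (W.image f) \ C, (((A ∩ W).filter fun v => f v = c).card : ℝ) := by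
    have := (card_le_card hsub).trans ((card_union_le _ _).trans
      (Nat.add_le_add_left card_biUnion_le _))
    exact_mod_cast this
  have h2 : ∑ c ∈ (W.image f) \ C, (((A ∩ W).filter fun v => f v = c).card : ℝ) ≤
      ∑ _c ∈ (W.image f) \ C, ε * A.card := by
    refine sum_le_sum fun c hc => ?_
    obtain ⟨hc1, hc2⟩ := mem_sdiff.1 hc
    by_contra! hlt
    exact hc2 (mem_filter.2 ⟨hc1, hlt.le⟩)
  rw [sum_const, nsmul_eq_mul] at h2
  have h3 : (((W.image f) \ C).card : ℝ) ≤ M := by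
    exact_mod_cast (card_le_card sdiff_subset).trans hM
  have h4 : (((W.image f) \ C).card : ℝ) * (ε * A.card) ≤ η / 2 * A.card := by
    calc _ ≤ M * (ε * A.card) := by gcongr
      _ = ε * M * A.card := by ring
      _ ≤ _ := by gcongr
  linarith

/-- A dense pair with two robust sides forces twice as many values. -/
theorem DensePair.two_pow_le [DecidableEq V] {G : ι → SimpleGraph V} {j : ι} {l : List ι}
    {η ε τ : ℝ} {p : Finset V × Finset V} (hp : DensePair (G j) ε τ p) (hε : 0 ≤ ε)
    (hεη : ε * 2 ^ (l.length + 1) ≤ η / 2) (h1 : Robust G l η p.1) (h2 : Robust G l η p.2)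
    {W : Finset V} {f : V → ℕ} (hW1 : ((p.1 \ W).card : ℝ) ≤ η / 2 * p.1.card)
    (hW2 : ((p.2 \ W).card : ℝ) ≤ η / 2 * p.2.card)
    (hf : ∀ u ∈ W, ∀ v ∈ W, ∀ i ∈ j :: l, (G i).Adj u v → f u ≠ f v) :
    2 ^ (l.length + 1) ≤ (W.image f).card := by
  classical
  by_contra! hlt
  have hf' : ∀ u ∈ W, ∀ v ∈ W, ∀ i ∈ l, (G i).Adj u v → f u ≠ f v :=
    fun u hu v hv i hi => hf u hu v hv i (List.mem_cons_of_mem _ hi)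
  have hεη' : ε * ((2 ^ (l.length + 1) : ℕ) : ℝ) ≤ η / 2 := by push_cast; exact hεη
  have k1 := h1.card_heavy_values hε hεη' hlt.le hW1 hf'
  have k2 := h2.card_heavy_values hε hεη' hlt.le hW2 hf'
  set C1 := (W.image f).filter fun c =>
    ε * p.1.card ≤ (((p.1 ∩ W).filter fun v => f v = c).card : ℝ)
  set C2 := (W.image f).filter fun c =>
    ε * p.2.card ≤ (((p.2 ∩ W).filter fun v => f v = c).card : ℝ)
  -- Two disjoint sets of 2^k frequent values would already give 2^(k+1) values.
  have hnd : ¬ Disjoint C1 C2 := by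
    intro hd
    have h3 := card_union_of_disjoint hd
    have h4 : (C1 ∪ C2).card ≤ (W.image f).card :=
      card_le_card (union_subset (filter_subset _ _) (filter_subset _ _))
    rw [pow_succ] at hlt
    omega
  obtain ⟨c, hc1, hc2⟩ := not_disjoint_iff.1 hnd
  obtain ⟨x, hx, y, hy, hxy⟩ := hp.2.2.2 _
    ((filter_subset (fun v => f v = c) _).trans inter_subset_left) _
    ((filter_subset (fun v => f v = c) _).trans inter_subset_left)
    (mem_filter.1 hc1).2 (mem_filter.1 hc2).2
  obtain ⟨hx1, hx2⟩ := mem_filter.1 hx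
  obtain ⟨hy1, hy2⟩ := mem_filter.1 hy
  exact hf x (mem_inter.1 hx1).2 y (mem_inter.1 hy1).2 j List.mem_cons_self hxy
    (hx2.trans hy2.symm)

-- If too few values are used, every pair with two robust sides must have lost at least an
-- η/4-proportion of its vertices, by `DensePair.two_pow_le`. These pairs carry more than half of a
-- mass of at least m|U|, so more than (ηm/8)|U| vertices would be missing.
open Classical in
theorem robust_cons [DecidableEq V] {G : ι → SimpleGraph V} {j : ι} {l : List ι}
    {η ε τ m : ℝ} (hε : 0 ≤ ε) (hη : 0 < η) (hεη : ε * 2 ^ (l.length + 1) ≤ η / 2) {U : Finset V}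
    {F : Finset (Finset V × Finset V)}
    (hF : ∀ p ∈ F, p.1 ⊆ U ∧ p.2 ⊆ U ∧ DensePair (G j) ε τ p)
    (hdis : (F : Set (Finset V × Finset V)).PairwiseDisjoint (fun p => p.1 ∪ p.2))
    (hm : m * U.card ≤ ∑ p ∈ F, ((p.1 ∪ p.2).card : ℝ))
    (hbad : ∑ p ∈ F with ¬ (Robust G l η p.1 ∧ Robust G l η p.2), ((p.1 ∪ p.2).card : ℝ) <
      (∑ p ∈ F, ((p.1 ∪ p.2).card : ℝ)) / 2) :
    Robust G (j :: l) (η * m / 8) U := by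
  intro W hW hc f hf
  rw [List.length_cons]
  by_contra hcon
  set F' := F.filter fun p => Robust G l η p.1 ∧ Robust G l η p.2
  have hpt : ∀ p ∈ F', η / 4 * ((p.1 ∪ p.2).card : ℝ) ≤ (((p.1 ∪ p.2) \ W).card : ℝ) := by
    intro p hp
    obtain ⟨hpF, h1, h2⟩ := mem_filter.1 hp
    have hD := (hF p hpF).2.2
    have hcard : ((p.1 ∪ p.2).card : ℝ) = 2 * p.1.card := by
      rw [card_union_of_disjoint hD.1, ← hD.2.1]; push_cast; ring
    rw [hcard]
    by_contra! hlt
    have e1 : ((p.1 \ W).card : ℝ) ≤ ((p.1 ∪ p.2) \ W).card := by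
      exact_mod_cast card_le_card (sdiff_subset_sdiff subset_union_left subset_rfl)
    have e2 : ((p.2 \ W).card : ℝ) ≤ ((p.1 ∪ p.2) \ W).card := by
      exact_mod_cast card_le_card (sdiff_subset_sdiff subset_union_right subset_rfl)
    refine hcon (hD.two_pow_le hε hεη h1 h2 (by linarith) ?_ hf)
    rw [← hD.2.1]
    linarith
  have hsum : ∑ p ∈ F', (((p.1 ∪ p.2) \ W).card : ℝ) ≤ (U \ W).card := by
    have hd : (F' : Set (Finset V × Finset V)).PairwiseDisjoint (fun p => (p.1 ∪ p.2) \ W) :=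
      fun p hp p' hp' hne => (hdis (mem_filter.1 hp).1 (mem_filter.1 hp').1 hne).mono
        sdiff_subset sdiff_subset
    rw [← Nat.cast_sum, ← card_biUnion hd]
    refine Nat.cast_le.2 (card_le_card (biUnion_subset.2 fun p hp => ?_))
    have := hF p (mem_filter.1 hp).1
    exact sdiff_subset_sdiff (union_subset this.1 this.2.1) subset_rfl
  have h1 := (sum_le_sum hpt).trans hsum
  rw [← mul_sum] at h1
  have h2 := sum_filter_add_sum_filter_not F (fun p => Robust G l η p.1 ∧ Robust G l η p.2)
    (fun p => ((p.1 ∪ p.2).card : ℝ))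
  have h3 : η * m / 8 * U.card ≤ η / 8 * ∑ p ∈ F, ((p.1 ∪ p.2).card : ℝ) := by
    calc _ = η / 8 * (m * U.card) := by ring
      _ ≤ _ := by gcongr
  change ∑ p ∈ F', ((p.1 ∪ p.2).card : ℝ) + _ = _ at h2
  nlinarith

/-! ### Counting bad lists and iterating -/

open Classical in
/-- If each `p` is bad for few `l`, then few `l` are bad for half of the total weight. -/
theorem card_filter_half_weight_le {α β : Type*} (L : Finset α) (F : Finset β) (w : β → ℝ)
    (hw : ∀ p ∈ F, 0 ≤ w p) (bad : α → β → Prop) {δ : ℝ}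
    (h : ∀ p ∈ F, ((L.filter fun l => bad l p).card : ℝ) ≤ δ * L.card) (hM : 0 < ∑ p ∈ F, w p) :
    ((L.filter fun l => (∑ p ∈ F, w p) / 2 ≤ ∑ p ∈ F with bad l p, w p).card : ℝ) ≤
      2 * δ * L.card := by
  set M := ∑ p ∈ F, w p
  set B := L.filter fun l => M / 2 ≤ ∑ p ∈ F with bad l p, w p
  have h1 : ∑ _l ∈ B, M / 2 ≤ ∑ l ∈ L, ∑ p ∈ F with bad l p, w p := by
    refine (sum_le_sum fun l hl => (mem_filter.1 hl).2).trans
      (sum_le_sum_of_subset_of_nonneg (filter_subset _ _) fun l _ _ => ?_)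
    exact sum_nonneg fun p hp => hw p (mem_filter.1 hp).1
  have h2 : ∑ l ∈ L, ∑ p ∈ F with bad l p, w p ≤ ∑ p ∈ F, δ * L.card * w p := by
    simp only [sum_filter]
    rw [sum_comm]
    refine sum_le_sum fun p hp => ?_
    rw [← sum_filter, sum_const, nsmul_eq_mul]
    exact mul_le_mul_of_nonneg_right (h p hp) (hw p hp)
  rw [← mul_sum] at h2
  rw [sum_const, nsmul_eq_mul] at h1
  refine le_of_mul_le_mul_right ?_ (half_pos hM)
  change (B.card : ℝ) * (M / 2) ≤ _
  linarith

open Classical in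
/-- Passing from robust lists of colors to robust lists that are longer by one. -/
theorem card_filter_not_robust_cons_le [Fintype ι] [DecidableEq V] {G : ι → SimpleGraph V}
    {k : ℕ} {η ε τ m γ δ : ℝ} (hε : 0 ≤ ε) (hη : 0 < η) (hεη : ε * 2 ^ (k + 1) ≤ η / 2)
    (hm : 0 < m) (hδ : 0 ≤ δ) {U : Finset V} (hU : U.Nonempty) (T : Finset ι)
    (L : Finset (List ι)) (hL : ∀ l ∈ L, l.length = k)
    (hT : ((T.filter fun i => ¬ Heavy (G i) ε τ m U).card : ℝ) ≤ γ * T.card)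
    (hrob : ∀ A ⊆ U, τ ≤ A.card →
      ((L.filter fun l => ¬ Robust G l η A).card : ℝ) ≤ δ * L.card) :
    ((((T ×ˢ L).image fun x => x.1 :: x.2).filter
      fun l => ¬ Robust G l (η * m / 8) U).card : ℝ) ≤
      (γ + 4 * δ) * ((T ×ˢ L).image fun x => x.1 :: x.2).card := by
  have hinj : Function.Injective fun x : ι × List ι => x.1 :: x.2 := by
    rintro ⟨a, b⟩ ⟨c, d⟩ h
    simpa using h
  have hU0 : (0 : ℝ) < U.card := by exact_mod_cast hU.card_pos
  rw [filter_image, card_image_of_injective _ hinj, card_image_of_injective _ hinj, card_product]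
  set J := T.filter fun i => ¬ Heavy (G i) ε τ m U
  -- A pair is bad for at most 2δ of the lists, δ for each side. Requiring bad pairs to make up half
  -- the weight doubles this to 4δ.
  have hheavy : ∀ j ∈ T \ J, ((L.filter fun l => ¬ Robust G (j :: l) (η * m / 8) U).card : ℝ) ≤
      4 * δ * L.card := by
    intro j hj
    obtain ⟨hjT, hjJ⟩ := mem_sdiff.1 hj
    have hH : Heavy (G j) ε τ m U := by
      by_contra hH
      exact hjJ (mem_filter.2 ⟨hjT, hH⟩)
    obtain ⟨F, hF, hdis, hmass⟩ := hH
    have hpair : ∀ p ∈ F, ((L.filter fun l => ¬ (Robust G l η p.1 ∧ Robust G l η p.2)).card : ℝ) ≤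
        2 * δ * L.card := by
      intro p hp
      obtain ⟨h1, h2, h3⟩ := hF p hp
      have k1 := hrob p.1 h1 h3.2.2.1
      have k2 := hrob p.2 h2 (h3.2.1 ▸ h3.2.2.1)
      have k3 : ((L.filter fun l => ¬ (Robust G l η p.1 ∧ Robust G l η p.2)).card : ℝ) ≤
          (L.filter fun l => ¬ Robust G l η p.1).card +
            (L.filter fun l => ¬ Robust G l η p.2).card := by
        simp only [not_and_or, filter_or]
        exact_mod_cast card_union_le _ _
      linarith
    have hM : 0 < ∑ p ∈ F, ((p.1 ∪ p.2).card : ℝ) := lt_of_lt_of_le (by positivity) hmass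
    have := card_filter_half_weight_le L F (fun p => ((p.1 ∪ p.2).card : ℝ))
      (fun _ _ => by positivity) (fun l p => ¬ (Robust G l η p.1 ∧ Robust G l η p.2))
      (δ := 2 * δ) (fun p hp => by convert hpair p hp) hM
    refine le_trans (Nat.cast_le.2 (card_le_card ?_)) (this.trans (by linarith))
    intro l hl
    obtain ⟨hlL, hlR⟩ := mem_filter.1 hl
    refine mem_filter.2 ⟨hlL, ?_⟩
    by_contra hge
    have hlt := not_le.1 hge
    exact hlR (robust_cons hε hη (by rw [hL l hlL]; exact hεη) hF hdis hmass
      (lt_of_eq_of_lt (by congr!) hlt))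
  have hsub : ((T ×ˢ L).filter fun x => ¬ Robust G (x.1 :: x.2) (η * m / 8) U) ⊆
      J ×ˢ L ∪ (T \ J).biUnion fun j =>
        (L.filter fun l => ¬ Robust G (j :: l) (η * m / 8) U).image fun l => (j, l) := by
    rintro ⟨j, l⟩ hx
    obtain ⟨hx1, hx2⟩ := mem_filter.1 hx
    obtain ⟨hj, hl⟩ := mem_product.1 hx1
    by_cases hjJ : j ∈ J
    · exact mem_union_left _ (mem_product.2 ⟨hjJ, hl⟩)
    · exact mem_union_right _ (mem_biUnion.2 ⟨j, mem_sdiff.2 ⟨hj, hjJ⟩,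
        mem_image_of_mem _ (mem_filter.2 ⟨hl, hx2⟩)⟩)
  have h1 : (((T ×ˢ L).filter fun x => ¬ Robust G (x.1 :: x.2) (η * m / 8) U).card : ℝ) ≤
      J.card * L.card + ∑ j ∈ T \ J,
        ((L.filter fun l => ¬ Robust G (j :: l) (η * m / 8) U).card : ℝ) := by
    have := (card_le_card hsub).trans ((card_union_le _ _).trans (Nat.add_le_add_left
      (card_biUnion_le.trans (sum_le_sum fun j _ => card_image_le)) _))
    rw [card_product] at this
    exact_mod_cast this
  have h2 := sum_le_sum hheavy
  rw [sum_const, nsmul_eq_mul] at h2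
  have h3 : ((T \ J).card : ℝ) * (4 * δ * L.card) ≤ T.card * (4 * δ * L.card) := by
    have h5 : ((T \ J).card : ℝ) ≤ T.card := by exact_mod_cast card_le_card sdiff_subset
    gcongr
  have h6 : (J.card : ℝ) * L.card ≤ γ * T.card * L.card := by gcongr
  push_cast
  linarith

-- Zones are nested, and the size threshold σ of one zone serves as the minimum size τ of dense
-- pairs in the next. The sides of those pairs are thus large enough for the robustness already
-- obtained, and a new color is prepended. The recursion δ ↦ γ + 4δ from 0 gives γ(4^k - 1)/3.
open Classical in
theorem exists_robust_lists [Fintype V] [DecidableEq V] [Fintype ι] [Nonempty ι]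
    (G : ι → SimpleGraph V) (hG : ∀ u v, u ≠ v → ∃ i, (G i).Adj u v) {ε s γ : ℝ} (hε : 0 < ε)
    (hε' : ε ≤ 1 / 4) (hs0 : 0 < s) (hs1 : s < 1) (hs : ε ^ (-s) * (1 - ε) < 1 - s)
    (hγ0 : 0 < γ) (q : ℕ) (m η D lam : ℕ → ℝ)
    (hη0 : η 0 = 1 / 2) (hη : ∀ k < q, η (k + 1) = η k * m k / 8)
    (hεη : ∀ k < q, ε * 2 ^ (k + 1) ≤ η k / 2) (hm0 : ∀ k < q, 0 < m k)
    (hm : ∀ k < q, m k ≤ 1 / 8) (hD : ∀ k ≤ q, 0 ≤ D k)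
    (hlam : ∀ k < q, D (k + 1) + 8 * m k * Fintype.card ι + 1 ≤ lam k * (γ / 2))
    (hDD : ∀ k < q, Real.log 3 + Real.log (Fintype.card ι) / s + 8 * m k * Fintype.card ι +
      D (k + 1) + 1 + lam k * Real.log (Fintype.card ι) ≤ D k)
    (hV : Real.exp (D 0) ≤ Fintype.card V) (k : ℕ) (hk : k ≤ q) :
    ∃ (U : Finset V) (σ : ℝ) (L : Finset (List ι)), 1 ≤ σ ∧ L.Nonempty ∧
      (∀ l ∈ L, l.length = k) ∧ σ * Real.exp (D k) ≤ U.card ∧ 0 < η k ∧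
      ∀ U' ⊆ U, σ ≤ U'.card → ((L.filter fun l => ¬ Robust G l (η k) U').card : ℝ) ≤
        γ * ((4 ^ k - 1) / 3) * L.card := by
  have hr0 : (0 : ℝ) < Fintype.card ι := by exact_mod_cast Fintype.card_pos
  induction k with
  | zero =>
    refine ⟨univ, 1, {[]}, le_rfl, by simp, by simp, by simpa using hV, by rw [hη0]; norm_num,
      fun U' _ hU' => ?_⟩
    have hne : U'.Nonempty := card_pos.1 (by exact_mod_cast zero_lt_one.trans_le hU')
    have := robust_nil G (η := η 0) (by rw [hη0]; norm_num) hne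
    simp [filter_singleton, this]
  | succ k ih =>
    obtain ⟨U₀, σ, L, hσ, hL, hlen, hU₀, hηk, hrob⟩ := ih (by omega)
    have hkq : k < q := by omega
    have hbound : 3 * σ * (Fintype.card ι : ℝ) ^ (1 / s) ≤
        Real.exp (-(8 * m k * Fintype.card ι + D (k + 1) + 1)) *
          ((Fintype.card ι : ℝ) ^ (-lam k) * U₀.card) := by
      rw [Real.rpow_def_of_pos hr0, Real.rpow_def_of_pos hr0]
      have h3 : (3 : ℝ) = Real.exp (Real.log 3) := (Real.exp_log (by norm_num)).symm
      calc 3 * σ * Real.exp (Real.log (Fintype.card ι) * (1 / s))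
          = σ * Real.exp (Real.log 3 + Real.log (Fintype.card ι) / s) := by
            rw [Real.exp_add, ← h3]; ring_nf
        _ ≤ σ * Real.exp (-(8 * m k * Fintype.card ι + D (k + 1) + 1) +
            Real.log (Fintype.card ι) * -lam k + D k) := by
          refine mul_le_mul_of_nonneg_left (Real.exp_le_exp.2 ?_) (by linarith)
          linarith [hDD k hkq]
        _ = Real.exp (-(8 * m k * Fintype.card ι + D (k + 1) + 1)) *
            (Real.exp (Real.log (Fintype.card ι) * -lam k) * (σ * Real.exp (D k))) := by
          rw [Real.exp_add, Real.exp_add]; ring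
        _ ≤ _ := by gcongr
    obtain ⟨U, hU, hUc, hT, hheavy⟩ := exists_zone G hG hε hε' hs0 hs1 hs hσ (hm0 k hkq).le
      (hm k hkq) hγ0 (hD (k + 1) hk) (hlam k hkq) hbound
    have hσ' : 1 ≤ Real.exp (-D (k + 1)) * U.card := by
      have h1 : Real.exp (-(8 * m k * Fintype.card ι + D (k + 1) + 1)) *
          ((Fintype.card ι : ℝ) ^ (-lam k) * U₀.card) ≤ Real.exp (-D (k + 1)) * U.card := by
        have : 0 ≤ 8 * m k * Fintype.card ι := by have := hm0 k hkq; positivity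
        gcongr
        linarith
      have h2 : 1 ≤ (Fintype.card ι : ℝ) ^ (1 / s) :=
        Real.one_le_rpow (by exact_mod_cast Fintype.card_pos) (by positivity)
      nlinarith
    -- The new threshold is the least size at which the zone property still controls subsets of `U`.
    refine ⟨U, Real.exp (-D (k + 1)) * U.card,
      (denseColors G ε σ U ×ˢ L).image fun x => x.1 :: x.2, hσ', (hT.product hL).image _, ?_, ?_,
      ?_, ?_⟩
    · intro l hl
      obtain ⟨⟨j, l'⟩, hx, rfl⟩ := mem_image.1 hl
      simp [hlen l' (mem_product.1 hx).2]
    · rw [mul_right_comm, ← Real.exp_add]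
      simp
    · rw [hη k hkq]
      have := hm0 k hkq
      positivity
    · intro U' hU' hc
      have h4 : (1 : ℝ) ≤ 4 ^ k := one_le_pow₀ (by norm_num)
      have hδ : 0 ≤ γ * (((4 : ℝ) ^ k - 1) / 3) :=
        mul_nonneg hγ0.le (div_nonneg (by linarith) (by norm_num))
      have hne : U'.Nonempty := card_pos.1 (by exact_mod_cast zero_lt_one.trans_le (hσ'.trans hc))
      have := card_filter_not_robust_cons_le (G := G) hε.le hηk (hεη k hkq) (hm0 k hkq) hδ hne
        (denseColors G ε σ U) L hlen (hheavy U' hU' hc)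
        (fun A hA hAc => hrob A (hA.trans (hU'.trans hU)) hAc)
      rw [← hη k hkq] at this
      convert this using 2
      ring

/-! ### Choice of parameters -/

/-- An `s` of order ε/log(1/ε) suffices: then ε^(-s) ≤ exp(ε/4) ≤ 1/(1 - ε/4), and 1 - ε < (1 -
ε/4)². -/
theorem rpow_neg_mul_one_sub_lt {ε s : ℝ} (hε : 0 < ε) (hε' : ε ≤ 1 / 4) (hs : s ≤ ε / 4)
    (hlog : s * Real.log (1 / ε) ≤ ε / 4) : ε ^ (-s) * (1 - ε) < 1 - s := by
  have h1 : ε ^ (-s) = Real.exp (s * Real.log (1 / ε)) := by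
    rw [Real.rpow_def_of_pos hε, one_div, Real.log_inv]; ring_nf
  have h2 : ε ^ (-s) ≤ Real.exp (ε / 4) := h1 ▸ Real.exp_le_exp.2 hlog
  have h3 : Real.exp (ε / 4) * (1 - ε / 4) ≤ 1 := by
    calc _ ≤ Real.exp (ε / 4) * Real.exp (-(ε / 4)) :=
          mul_le_mul_of_nonneg_left (by linarith [Real.add_one_le_exp (-(ε / 4))]) (by positivity)
      _ = 1 := by rw [← Real.exp_add]; simp
  have h4 : Real.exp (ε / 4) ≤ 1 / (1 - ε / 4) := (le_div_iff₀ (by linarith)).2 h3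
  calc ε ^ (-s) * (1 - ε) ≤ 1 / (1 - ε / 4) * (1 - ε) :=
        mul_le_mul_of_nonneg_right (h2.trans h4) (by linarith)
    _ < 1 - ε / 4 := by
      rw [one_div, ← div_eq_inv_mul, div_lt_iff₀ (by linarith)]
      nlinarith
    _ ≤ 1 - s := by linarith

/-- A choice of parameters satisfying the requirements of `exists_robust_lists`. -/
theorem exists_parameters (q : ℕ) (hq : 2 ≤ q) :
    ∃ K : ℝ, 2 ≤ K ∧ ∀ r : ℝ, 2 ≤ r → ∃ (ε s γ : ℝ) (m η D lam : ℕ → ℝ),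
      0 < ε ∧ ε ≤ 1 / 4 ∧ 0 < s ∧ s < 1 ∧ ε ^ (-s) * (1 - ε) < 1 - s ∧ 0 < γ ∧
      γ * ((4 ^ q - 1) / 3) < 1 ∧ η 0 = 1 / 2 ∧ (∀ k < q, η (k + 1) = η k * m k / 8) ∧
      (∀ k < q, ε * 2 ^ (k + 1) ≤ η k / 2) ∧ (∀ k < q, 0 < m k) ∧ (∀ k < q, m k ≤ 1 / 8) ∧
      (∀ k ≤ q, 0 ≤ D k) ∧ (∀ k < q, D (k + 1) + 8 * m k * r + 1 ≤ lam k * (γ / 2)) ∧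
      (∀ k < q, Real.log 3 + Real.log r / s + 8 * m k * r + D (k + 1) + 1 +
        lam k * Real.log r ≤ D k) ∧
      D 0 = K ^ q * Real.log r ^ q * r ^ (1 - 1 / (q : ℝ)) := by
  have hq0 : (0 : ℝ) < q := by positivity
  have hq2 : (2 : ℝ) ≤ q := by exact_mod_cast hq
  set c : ℝ := 1 / (2 * 64 ^ (q - 1) * q * 2 ^ (q + 2)) with hc
  have hc0 : 0 < c := by positivity
  have hc1 : c ≤ 1 := by
    rw [hc, div_le_one (by positivity)]
    have h1 : (1 : ℝ) ≤ 64 ^ (q - 1) := one_le_pow₀ (by norm_num)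
    have h2 : (1 : ℝ) ≤ 2 ^ (q + 2) := one_le_pow₀ (by norm_num)
    calc (1 : ℝ) = 1 * 1 * 1 * 1 := by norm_num
      _ ≤ _ := by gcongr <;> linarith
  set B : ℝ := 2 * Real.log (2 / c) + 1 with hB
  have hlogc : 0 ≤ Real.log (2 / c) := Real.log_nonneg ((one_le_div hc0).2 (by linarith))
  have hB1 : 1 ≤ B := by linarith
  set κ : ℝ := c / (8 * B) with hκ
  have hκ0 : 0 < κ := by positivity
  set γ : ℝ := 1 / 4 ^ q with hγ
  have hγ0 : 0 < γ := by positivity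
  -- The summands pay, in this order, for the five terms bounded by D (k+1), for (log r)/s, and for
  -- λ log r.
  set K : ℝ := 10 + 1 / κ + 6 / γ with hK
  have hK10 : 10 ≤ K := by
    have : 0 < 1 / κ := by positivity
    have : 0 < 6 / γ := by positivity
    linarith
  refine ⟨K, by linarith, fun r hr => ?_⟩
  clear_value K γ κ B c
  have hr0 : 0 < r := by linarith
  set L := Real.log r with hL
  have hL2 : 1 / 2 ≤ L := by
    have := Real.log_le_log (by norm_num) hr
    linarith [Real.log_two_gt_d9]
  have hL0 : 0 < L := by linarith
  set a : ℝ := 1 - 1 / (q : ℝ) with ha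
  have hq1 : 1 / (q : ℝ) ≤ 1 := by rw [div_le_one hq0]; linarith
  have ha0 : 0 ≤ a := by linarith
  have ha1 : a ≤ 1 := by have : 0 < 1 / (q : ℝ) := by positivity
                         linarith
  set ρ : ℝ := r ^ (-(1 / (q : ℝ))) with hρ
  have hρ0 : 0 < ρ := by positivity
  have hρ1 : ρ ≤ 1 := Real.rpow_le_one_of_one_le_of_nonpos (by linarith) (by simp)
  have hρr : ρ * r = r ^ a := by
    rw [ha, hρ, sub_eq_neg_add, Real.rpow_add hr0, Real.rpow_one]
  have hρL : ρ * L ≤ q := by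
    have h1 := Real.log_le_sub_one_of_pos (show 0 < r ^ (1 / (q : ℝ)) by positivity)
    rw [Real.log_rpow hr0] at h1
    have h2 : L ≤ q * r ^ (1 / (q : ℝ)) := by
      have h3 : 1 / (q : ℝ) * L ≤ r ^ (1 / (q : ℝ)) := by linarith
      calc L = q * (1 / (q : ℝ) * L) := by field_simp
        _ ≤ _ := by gcongr
    calc ρ * L ≤ ρ * (q * r ^ (1 / (q : ℝ))) := by gcongr
      _ = q * (ρ * r ^ (1 / (q : ℝ))) := by ring
      _ = q := by rw [hρ, ← Real.rpow_add hr0]; simp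
  have hρa : ρ ^ (q - 1) = r ^ (-a) := by
    rw [hρ, ← Real.rpow_natCast, ← Real.rpow_mul hr0.le, Nat.cast_sub (by omega), ha]
    congr 1
    field_simp
    push_cast
    ring
  set R : ℝ := r ^ a with hR
  have hR1 : 1 ≤ R := Real.one_le_rpow (by linarith) ha0
  have hRinv : r ^ (-a) = R⁻¹ := Real.rpow_neg hr0.le a
  clear_value R ρ a
  -- With m about r^(-1/q), m r is about r^(1-1/q). The extra log r in m 0 passes into ε and cancels
  -- the log(1/ε) that `s` must absorb; ρ log r ≤ q keeps m 0 ≤ 1/8.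
  set m : ℕ → ℝ := fun k => if k = 0 then ρ * L / (8 * q) else ρ / 8 with hm
  obtain ⟨η, hηz, hηs⟩ : ∃ η : ℕ → ℝ, η 0 = 1 / 2 ∧ ∀ k, η (k + 1) = η k * m k / 8 :=
    ⟨fun k => Nat.rec (1 / 2) (fun k x => x * m k / 8) k, rfl, fun _ => rfl⟩
  have hm0 : ∀ k, 0 < m k := by
    intro k
    simp only [hm]
    split_ifs <;> positivity
  have hm8 : ∀ k, m k ≤ 1 / 8 := by
    intro k
    simp only [hm]
    split_ifs
    · rw [div_le_iff₀ (by positivity)]; linarith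
    · linarith
  have hη0 : ∀ k, 0 < η k := by
    intro k
    induction k with
    | zero => rw [hηz]; exact one_half_pos
    | succ k ih => rw [hηs]; have := hm0 k; positivity
  have hanti : Antitone η := antitone_nat_of_succ_le fun k => by
    rw [hηs]
    have := mul_le_mul_of_nonneg_left (hm8 k) (hη0 k).le
    linarith [hη0 k]
  have hform : ∀ k, η (k + 1) = ρ ^ (k + 1) * L / (2 * 64 ^ (k + 1) * q) := by
    intro k
    induction k with
    | zero =>
      rw [hηs, hηz]
      simp only [hm, if_true]
      field_simp
      ring
    | succ k ih =>
      rw [hηs, ih]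
      simp only [hm, Nat.succ_ne_zero, if_false]
      field_simp
      ring
  -- The constraints on ε involve η only up to index q - 1, hence just q - 1 factors m, and ρ^(q-1)
  -- = r^(-(1-1/q)).
  set ε : ℝ := η (q - 1) / 2 ^ (q + 2) with hε
  have hε0 : 0 < ε := by have := hη0 (q - 1); positivity
  have hε4 : ε ≤ 1 / 4 := by
    rw [hε, div_le_iff₀ (by positivity)]
    have h1 : η (q - 1) ≤ 1 / 2 := (hanti (Nat.zero_le _)).trans_eq hηz
    have h2 : (2 : ℝ) ^ 2 ≤ 2 ^ (q + 2) := pow_le_pow_right₀ (by norm_num) (by omega)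
    linarith
  have hεc : ε = c * L * R⁻¹ := by
    have := hform (q - 2)
    rw [show q - 2 + 1 = q - 1 by omega, hρa, hRinv] at this
    rw [hε, this, hc]
    field_simp
  set s : ℝ := κ * R⁻¹ with hs
  have hs0 : 0 < s := by positivity
  have hRi0 : 0 < R⁻¹ := by positivity
  have hκc : κ ≤ c / 8 := by
    rw [hκ]
    exact div_le_div_of_nonneg_left hc0.le (by norm_num) (by linarith)
  have hsε : s ≤ ε / 4 := by
    rw [hs, hεc]
    have : κ ≤ c * L / 4 := by
      have := mul_le_mul_of_nonneg_left hL2 hc0.le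
      linarith
    calc κ * R⁻¹ ≤ c * L / 4 * R⁻¹ := by gcongr
      _ = _ := by ring
  have hlogε : Real.log (1 / ε) ≤ B * L := by
    have h1 : 1 / ε ≤ 2 / c * R := by
      rw [hεc, div_le_iff₀ (by positivity)]
      have : 2 / c * R * (c * L * R⁻¹) = 2 * L := by field_simp
      rw [this]
      linarith
    have h2 := Real.log_le_log (by positivity) h1
    rw [Real.log_mul (by positivity) (by positivity), hR, Real.log_rpow hr0] at h2
    have h3 := mul_le_mul_of_nonneg_left hL2 hlogc
    have h4 : a * L ≤ L := mul_le_of_le_one_left hL0.le ha1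
    rw [hB]
    linarith
  have hslog : s * Real.log (1 / ε) ≤ ε / 4 := by
    calc s * Real.log (1 / ε) ≤ s * (B * L) := by gcongr
      _ = c * L * R⁻¹ / 8 := by rw [hs, hκ]; field_simp
      _ ≤ ε / 4 := by rw [hεc]; have : 0 < c * L * R⁻¹ := by positivity
                      linarith
  clear_value s ε
  have hKL : 1 ≤ K * L := by
    have := mul_le_mul hK10 hL2 (by norm_num) (by linarith)
    linarith
  -- Each level costs a factor K log r, because λ is of order D (k+1) and is multiplied by log r.
  -- This is the source of (log r)^q.
  set D : ℕ → ℝ := fun k => (K * L) ^ (q - k) * R with hD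
  have hXE : ∀ k < q, 8 * m k * r ≤ D (k + 1) := by
    intro k hk
    simp only [hm, hD]
    split_ifs with h0
    -- As q ≥ 2, D 1 retains a factor K log r, which absorbs the extra logarithm in m 0.
    · have h1 : K * L ≤ (K * L) ^ (q - (k + 1)) := le_self_pow₀ hKL (by omega)
      calc 8 * (ρ * L / (8 * q)) * r = (L / q) * (ρ * r) := by field_simp
        _ = (L / q) * R := by rw [hρr]
        _ ≤ (K * L) ^ (q - (k + 1)) * R := by
          gcongr
          refine le_trans ?_ h1
          rw [div_le_iff₀ hq0]
          calc L ≤ K * L := le_mul_of_one_le_left hL0.le (by linarith)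
            _ ≤ K * L * q := le_mul_of_one_le_right (by linarith) (by linarith)
    · calc 8 * (ρ / 8) * r = 1 * R := by rw [← hρr]; ring
        _ ≤ _ := by gcongr; exact one_le_pow₀ hKL
  have hE1 : ∀ k, 1 ≤ D k := fun k => one_le_mul_of_one_le_of_one_le (one_le_pow₀ hKL) hR1
  have hER : ∀ k, R ≤ D k := fun k => le_mul_of_one_le_left (by linarith) (one_le_pow₀ hKL)
  have hDs : ∀ k < q, D k = K * L * D (k + 1) := by
    intro k hk
    simp only [hD]
    rw [show q - k = q - (k + 1) + 1 by omega, pow_succ]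
    ring
  refine ⟨ε, s, γ, m, η, D, fun k => 2 / γ * (D (k + 1) + 8 * m k * r + 1), hε0, hε4, hs0,
    by linarith, rpow_neg_mul_one_sub_lt hε0 hε4 hsε hslog, hγ0, ?_, hηz, fun k _ => hηs k, ?_,
    fun k _ => hm0 k, fun k _ => hm8 k, fun k _ => by linarith [hE1 k], ?_, ?_, ?_⟩
  · rw [hγ, div_mul_eq_mul_div, one_mul, div_lt_one (by positivity)]
    have : (0 : ℝ) < 4 ^ q := by positivity
    linarith
  · intro k hk
    have h1 : η (q - 1) ≤ η k := hanti (by omega)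
    have h2 : (2 : ℝ) ^ (k + 1) ≤ 2 ^ (q + 1) := pow_le_pow_right₀ (by norm_num) (by omega)
    calc ε * 2 ^ (k + 1) ≤ ε * 2 ^ (q + 1) := by gcongr
      _ = η (q - 1) / 2 := by rw [hε]; field_simp; ring
      _ ≤ _ := by linarith
  · intro k _
    apply le_of_eq
    field_simp
  · intro k hk
    beta_reduce
    rw [hDs k hk]
    have e1 := hXE k hk
    have e2 := hE1 (k + 1)
    have e3 := hER (k + 1)
    have e4 : Real.log 3 ≤ 2 := by
      have := Real.log_le_sub_one_of_pos (show (0 : ℝ) < 3 by norm_num)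
      linarith
    generalize D (k + 1) = E at *
    have e5 : L / s ≤ 1 / κ * (L * E) := by
      calc L / s = 1 / κ * (L * R) := by rw [hs]; field_simp
        _ ≤ _ := by gcongr
    have e6 : 2 / γ * (E + 8 * m k * r + 1) * L ≤ 6 / γ * (L * E) := by
      calc _ ≤ 2 / γ * (E + E + E) * L := by gcongr
        _ = _ := by ring
    have e7 : 5 * E ≤ 10 * (L * E) := by
      have := mul_le_mul_of_nonneg_right hL2 (show 0 ≤ E by linarith)
      linarith
    calc _ ≤ 5 * E + 1 / κ * (L * E) + 6 / γ * (L * E) := by linarith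
      _ ≤ 10 * (L * E) + 1 / κ * (L * E) + 6 / γ * (L * E) := by linarith
      _ = K * L * E := by rw [hK]; ring
  · simp only [hD, Nat.sub_zero, mul_pow]

/-! ### From chromatic colorings to the Ramsey number -/

/-- An optimal coloring restricted to `p` of its classes: a graph that is not `(p - 1)`-colorable has
an induced subgraph of chromatic number exactly `p`. -/
theorem exists_induce_chromaticNumber_eq {V : Type*} [Finite V] (G : SimpleGraph V) {p : ℕ}
    (h : ¬ G.Colorable (p - 1)) : ∃ s : Set V, (G.induce s).chromaticNumber = p := by
  classical
  obtain ⟨N, hN⟩ : ∃ N, G.Colorable N ∧ ∀ k < N, ¬ G.Colorable k := by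
    have hex : ∃ N, G.Colorable N := by
      have := Fintype.ofFinite V
      exact ⟨_, G.colorable_of_fintype⟩
    exact ⟨Nat.find hex, Nat.find_spec hex, fun k hk => Nat.find_min hex hk⟩
  have hpN : p ≤ N := by
    by_contra! hlt
    exact h (hN.1.mono (by omega))
  obtain ⟨f⟩ := hN.1
  set s : Set V := {v | (f v : ℕ) < p}
  refine ⟨s, le_antisymm ?_ ?_⟩
  · refine SimpleGraph.chromaticNumber_le_iff_colorable.2
      ⟨SimpleGraph.Coloring.mk (fun v => ⟨f v, v.2⟩) ?_⟩
    intro u v huv heq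
    exact f.valid huv (Fin.ext (by simpa using heq))
  · rcases Nat.eq_zero_or_pos p with rfl | hp
    · simp
    by_contra! hlt
    have hcol : (G.induce s).Colorable (p - 1) := by
      rw [← SimpleGraph.chromaticNumber_le_iff_colorable]
      refine Order.le_of_lt_add_one ?_
      convert hlt using 1
      exact_mod_cast Nat.sub_add_cancel hp
    obtain ⟨g⟩ := hcol
    -- A (p-1)-coloring of the first p classes, together with the remaining classes shifted down by
    -- one, would color `G` with N - 1 colors.
    refine hN.2 (N - 1) (by omega) ⟨SimpleGraph.Coloring.mk
      (fun v => if hv : v ∈ s then ⟨g ⟨v, hv⟩, by omega⟩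
        else ⟨f v - 1, by have := (f v).2; have : p ≤ f v := not_lt.1 hv; omega⟩) ?_⟩
    intro u v huv heq
    by_cases hu : u ∈ s <;> by_cases hv : v ∈ s
    · simp only [hu, hv, dif_pos, Fin.mk.injEq] at heq
      exact g.valid (v := ⟨u, hu⟩) (w := ⟨v, hv⟩) huv (Fin.ext heq)
    · simp only [hu, hv, dif_pos, dif_neg, not_false_eq_true, Fin.mk.injEq] at heq
      have h1 := (g ⟨u, hu⟩).2
      have h2 : p ≤ f v := not_lt.1 hv
      omega
    · simp only [hu, hv, dif_pos, dif_neg, not_false_eq_true, Fin.mk.injEq] at heq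
      have h1 := (g ⟨v, hv⟩).2
      have h2 : p ≤ f u := not_lt.1 hu
      omega
    · simp only [hu, hv, dif_neg, not_false_eq_true, Fin.mk.injEq] at heq
      have h1 : p ≤ f u := not_lt.1 hu
      have h2 : p ≤ f v := not_lt.1 hv
      exact f.valid huv (Fin.ext (by omega))

/-- A violating union of at most k - 1 classes contains an induced p-chromatic subgraph, whose edges
use only the colors of that union. -/
theorem forces_of_forall_not_isChromaticColoring {r p k n : ℕ}
    (h : ∀ c : SimpleGraph.TopEdgeLabeling (Fin n) (Fin r), ¬ IsChromaticColoring p k c) :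
    Forces r p k n := by
  intro c
  have hc := h c
  simp only [IsChromaticColoring, not_forall] at hc
  obtain ⟨S, hS, hchi⟩ := hc
  rw [SimpleGraph.chromaticNumber_le_iff_colorable] at hchi
  set G := ⨆ i ∈ S, c.labelGraph i with hG
  obtain ⟨s, hs⟩ := exists_induce_chromaticNumber_eq G hchi
  let H : (⊤ : SimpleGraph (Fin n)).Subgraph :=
    { verts := s
      Adj := fun u v => u ∈ s ∧ v ∈ s ∧ G.Adj u v
      adj_sub := fun h => h.2.2.ne
      edge_vert := fun h => h.1
      symm := ⟨fun u v h => ⟨h.2.1, h.1, h.2.2.symm⟩⟩ }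
  refine ⟨H, ?_, ?_⟩
  · have : H.coe = G.induce s := by
      ext u v
      simp only [SimpleGraph.Subgraph.coe_adj, SimpleGraph.comap_adj,
        Function.Embedding.subtype_apply]
      exact ⟨fun h => h.2.2, fun h => ⟨u.2, v.2, h⟩⟩
    rw [this]
    exact hs
  · have hsub : colorsOn c H ⊆ (S : Set (Fin r)) := by
      rintro i ⟨e, he, rfl⟩
      induction e using Sym2.ind with
      | _ u v =>
        have huv : G.Adj u v := (SimpleGraph.Subgraph.mem_edgeSet.1 he).2.2
        simp only [hG, SimpleGraph.iSup_adj, SimpleGraph.EdgeLabeling.labelGraph_adj] at huv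
        obtain ⟨i, hi, _, hci⟩ := huv
        rw [hci]
        exact hi
    calc (colorsOn c H).ncard ≤ (S : Set (Fin r)).ncard := Set.ncard_le_ncard hsub
      _ = S.card := Set.ncard_coe_finset S
      _ ≤ k - 1 := hS

-- A robust list of length q on a zone contradicts a proper coloring with 2^q - 1 values. The lower
-- bound on the exponent is kept for rounding up later.
open Classical in
theorem card_lt_of_isChromaticColoring (q : ℕ) (hq : 2 ≤ q) :
    ∃ C : ℝ, ∀ r : ℕ, 2 ≤ r →
      1 ≤ C * (r : ℝ) ^ (1 - 1 / (q : ℝ)) * Real.log (r : ℝ) ^ q ∧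
      ∀ (n : ℕ) (c : SimpleGraph.TopEdgeLabeling (Fin n) (Fin r)),
        IsChromaticColoring (2 ^ q) (q + 1) c →
          (n : ℝ) < Real.exp (C * (r : ℝ) ^ (1 - 1 / (q : ℝ)) * Real.log (r : ℝ) ^ q) := by
  obtain ⟨K, hK, hpar⟩ := exists_parameters q hq
  refine ⟨K ^ q, fun r hr => ⟨?_, fun n c hc => ?_⟩⟩
  · have hr' : (2 : ℝ) ≤ r := by exact_mod_cast hr
    have hL : 1 / 2 ≤ Real.log r := by
      have := Real.log_le_log (by norm_num) hr'
      linarith [Real.log_two_gt_d9]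
    have h1 : 1 ≤ K * Real.log r := by nlinarith
    have h2 : (1 : ℝ) / q ≤ 1 := by
      rw [div_le_one (by positivity)]
      exact_mod_cast (by omega : 1 ≤ q)
    have h3 : (1 : ℝ) ≤ (r : ℝ) ^ (1 - 1 / (q : ℝ)) :=
      Real.one_le_rpow (by linarith) (by linarith)
    calc (1 : ℝ) ≤ (K * Real.log r) ^ q * (r : ℝ) ^ (1 - 1 / (q : ℝ)) :=
          one_le_mul_of_one_le_of_one_le (one_le_pow₀ h1) h3
      _ = _ := by rw [mul_pow]; ring
  · by_contra! hge
    obtain ⟨ε, s, γ, m, η, D, lam, hε, hε', hs0, hs1, hs, hγ, hγ1, hη0, hη, hεη, hm0, hm, hD, hlam,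
      hDD, hD0⟩ := hpar r (by exact_mod_cast hr)
    have : Nonempty (Fin r) := ⟨⟨0, by omega⟩⟩
    obtain ⟨U, σ, L, hσ, hL, hlen, hU, hηq, hrob⟩ := exists_robust_lists
      (fun i : Fin r => c.labelGraph i)
      (fun u v huv => ⟨c ⟨s(u, v), huv⟩, (SimpleGraph.EdgeLabeling.labelGraph_adj _ _).2
        ⟨huv, rfl⟩⟩)
      hε hε' hs0 hs1 hs hγ q m η D lam hη0 hη hεη hm0 hm hD (by simpa using hlam)
      (by simpa using hDD) (by
        rw [hD0, Fintype.card_fin, mul_right_comm]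
        exact hge) q le_rfl
    have hσU : σ ≤ U.card := by
      refine le_trans ?_ hU
      exact le_mul_of_one_le_right (by linarith) (Real.one_le_exp (hD q le_rfl))
    -- The proportion of bad lists is at most γ(4^q - 1)/3 < 1.
    obtain ⟨l, hl, hlR⟩ : ∃ l ∈ L, Robust (fun i : Fin r => c.labelGraph i) l (η q) U := by
      by_contra! hcon
      have h1 := hrob U subset_rfl hσU
      rw [filter_true_of_mem hcon] at h1
      have h2 : (0 : ℝ) < L.card := by exact_mod_cast hL.card_pos
      nlinarith
    have hlq := hlen l hl
    -- Repeated colors in the list are harmless: the hypothesis covers unions of fewer than q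
    -- classes too.
    have hcol := hc l.toFinset (by rw [Nat.add_sub_cancel, ← hlq]; exact l.toFinset_card_le)
    rw [SimpleGraph.chromaticNumber_le_iff_colorable] at hcol
    obtain ⟨f⟩ := hcol
    have h1 := hlR U subset_rfl (by simp; positivity) (fun v => (f v : ℕ)) (by
      intro u _ v _ i hi huv heq
      refine f.valid ?_ (Fin.ext heq)
      simp only [SimpleGraph.iSup_adj]
      exact ⟨i, List.mem_toFinset.2 hi, huv⟩)
    have h2 : (U.image fun v => (f v : ℕ)) ⊆ range (2 ^ q - 1) := by
      intro x hx
      obtain ⟨v, _, rfl⟩ := mem_image.1 hx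
      exact mem_range.2 (f v).2
    have h3 := card_le_card h2
    rw [card_range] at h3
    rw [hlq] at h1
    have : 0 < 2 ^ q := by positivity
    omega

end ChromaticRamsey

theorem mainTheorem1 (q : ℕ) (hq : 2 ≤ q) :
    ∃ C : ℝ, ∀ r : ℕ, 2 ≤ r →
      ((∃ n : ℕ, ChromaticRamsey.Forces r (2 ^ q) (q + 1) n) ∧
        (ChromaticRamsey.Fchi r (2 ^ q) (q + 1) : ℝ) ≤
          Real.exp (C * (r : ℝ) ^ (1 - 1 / (q : ℝ)) * Real.log (r : ℝ) ^ q)) ∧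
      (∀ (n : ℕ) (c : SimpleGraph.TopEdgeLabeling (Fin n) (Fin r)),
        ChromaticRamsey.IsChromaticColoring (2 ^ q) (q + 1) c →
          (n : ℝ) ≤ Real.exp (C * (r : ℝ) ^ (1 - 1 / (q : ℝ)) * Real.log (r : ℝ) ^ q)) := by
  obtain ⟨C, hC⟩ := ChromaticRamsey.card_lt_of_isChromaticColoring q hq
  -- Doubling the constant absorbs the ceiling: for X ≥ 1, e^X + 1 ≤ e^(2X).
  refine ⟨2 * C, fun r hr => ?_⟩
  obtain ⟨h1, hn⟩ := hC r hr
  rw [show 2 * C * (r : ℝ) ^ (1 - 1 / (q : ℝ)) * Real.log (r : ℝ) ^ q =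
    2 * (C * (r : ℝ) ^ (1 - 1 / (q : ℝ)) * Real.log (r : ℝ) ^ q) by ring]
  generalize C * (r : ℝ) ^ (1 - 1 / (q : ℝ)) * Real.log (r : ℝ) ^ q = X at *
  have hforces : ChromaticRamsey.Forces r (2 ^ q) (q + 1) ⌈Real.exp X⌉₊ :=
    ChromaticRamsey.forces_of_forall_not_isChromaticColoring fun c hc =>
      absurd (hn _ c hc) (not_lt.2 (Nat.le_ceil _))
  refine ⟨⟨⟨_, hforces⟩, ?_⟩, fun n c hc => (hn n c hc).le.trans (Real.exp_le_exp.2 (by linarith))⟩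
  have h2 : ChromaticRamsey.Fchi r (2 ^ q) (q + 1) ≤ ⌈Real.exp X⌉₊ := Nat.sInf_le hforces
  have h3 : (⌈Real.exp X⌉₊ : ℝ) < Real.exp X + 1 := Nat.ceil_lt_add_one (Real.exp_pos X).le
  have h4 : (2 : ℝ) ≤ Real.exp X := by linarith [Real.add_one_le_exp X]
  calc (ChromaticRamsey.Fchi r (2 ^ q) (q + 1) : ℝ) ≤ ⌈Real.exp X⌉₊ := by exact_mod_cast h2
    _ ≤ Real.exp X * Real.exp X := by nlinarith
    _ = Real.exp (2 * X) := by rw [← Real.exp_add]; ring_nf
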